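/- **Setting.** A team of $N$ agents acts in discrete time $t=1,2,\dots$. The state space $\mathcal S$ is a topological space with its Borel $\sigma$-algebra. The common-observation space $\mathcal O^0$, the private-observation spaces $\mathcal O^1,\dots,\mathcal O^N$ and the action spaces $\mathcal A^1,\dots,\mathcal A^N$ are finite; put $\mathcal O=\mathcal O^0\times\mathcal O^1\times\cdots\times\mathcal O^N$ and $\mathcal A=\mathcal A^1\times\cdots\times\mathcal A^N$. The initial pair $(S_1,O_1)$ has law $P_1$, a probability measure on $\mathcal S\times\mathcal O$, and given the past, $(S_{t+1},O_{t+1})$ is drawn from a (measurable) Markov transition law $P(S_t,A_t,\cdot)$ on $\mathcal S\times\mathcal O$. Write $H_t=(O_{1:t},A_{1:t-1})\in\mathcal H_t=\mathcal O^t\times\mathcal A^{t-1}$ for the joint history and $H^n_t=(O^n_{1:t},A^n_{1:t-1})\in\mathcal H^n_t=(\mathcal O^n)^t\times(\mathcal A^n)^{t-1}$ for the private history of agent $n$. A *prescription* at time $t$ is a tuple $\gamma=(\gamma^1,\dots,\gamma^N)$ of maps $\gamma^n:\mathcal H^n_t\to\mathcal A^n$; the finite set of them is $\mathcal G_t$.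 The coordinator's *prescription-observation history* is $\widetilde H_t=(O^0_{1:t},\Gamma_{1:t-1})\in\widetilde{\mathcal H}_t=(\mathcal O^0)^t\times\mathcal G_1\times\cdots\times\mathcal G_{t-1}$. A *behavioral coordination policy* is a sequence $v=(v_t)_{t\ge1}$ of maps $v_t:\widetilde{\mathcal H}_t\to M_1(\mathcal G_t)$, where $M_1(\cdot)$ denotes the set of Borel probability measures; under $v$, $\Gamma_t$ is drawn from $v_t(\widetilde H_t)$ and $A^n_t=\Gamma^n_t(H^n_t)$ for every $n$. Let $\mathcal V$ be the set of these policies, with the product topology of $\prod_t\prod_{\tilde h\in\widetilde{\mathcal H}_t}M_1(\mathcal G_t)$, and let $\mathcal V_{\rm pure}\subseteq\mathcal V$ be the policies all of whose values $v_t(\tilde h)$ are Dirac measures. Give $M_1(\mathcal V)$ the topology of weak convergence, and its subset $M_1(\mathcal V_{\rm pure})$ of measures concentrated on $\mathcal V_{\rm pure}$ the subspace topology. For $v\in\mathcal V$ let $\mathbb P_v$ be the law of the infinite trajectory $(S_t,O_t,\Gamma_t,A_t)_{t\ge1}$ (Ionescu-Tulcea); for $\nu\in M_1(\mathcal V)$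 let $\mathbb P_\nu$ be its law when a policy is first drawn from $\nu$ and then followed. For $T\in\mathbb N\cup\{\infty\}$ and $\alpha\in(0,1]$, the coordinator-level and the agent-level *occupation measures* of $x$ are the measures $\widetilde q_{T,\alpha}(x)$ on $\bigsqcup_{t=1}^{T}(\widetilde{\mathcal H}_t\times\mathcal G_t)$ and $q_{T,\alpha}(x)$ on $\bigsqcup_{t=1}^{T}(\mathcal H_t\times\mathcal A)$ with point masses $$\widetilde q_{T,\alpha}(x)(t,\tilde h,\gamma)=\alpha^{t-1}\,\mathbb P_x(\widetilde H_t=\tilde h,\ \Gamma_t=\gamma),\qquad q_{T,\alpha}(x)(t,h,a)=\alpha^{t-1}\,\mathbb P_x(H_t=h,\ A_t=a).$$ Put $m(T,\alpha)=\sum_{t=1}^{T}\alpha^{t-1}$. **Proposition.** Let $X$ be one of $\mathcal V$, $M_1(\mathcal V)$, $M_1(\mathcal V_{\rm pure})$. (A) The map $x\mapsto\widetilde q_{\infty,1}(x)$ on $X$ is pointwise continuous: for every $t$, $\tilde h$, $\gamma$ the map $x\mapsto\widetilde q_{\infty,1}(x)(t,\tilde h,\gamma)$ is continuous. Moreover,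 for all $(T,\alpha)\in(\mathbb N\cup\{\infty\})\times(0,1]$ with $(T,\alpha)\ne(\infty,1)$, every $\widetilde q_{T,\alpha}(x)$, $x\in X$, has total mass $m(T,\alpha)$, and the image $\widetilde q_{T,\alpha}(X)$ is compact in the weak topology of finite measures on the discrete space $\bigsqcup_{t=1}^{T}(\widetilde{\mathcal H}_t\times\mathcal G_t)$. (B) The set $\widetilde q_{\infty,1}(X)$ is convex, and $\widetilde q_{\infty,1}(X)=\widetilde q_{\infty,1}(\mathcal V)$. (C) The map $x\mapsto q_{\infty,1}(x)$ on $X$ is pointwise continuous: for every $t$, $h$, $a$ the map $x\mapsto q_{\infty,1}(x)(t,h,a)$ is continuous. Moreover, for all $(T,\alpha)$ as in (A), every $q_{T,\alpha}(x)$, $x\in X$, has total mass $m(T,\alpha)$, and the image $q_{T,\alpha}(X)$ is compact in the weak topology of finite measures on the discrete space $\bigsqcup_{t=1}^{T}(\mathcal H_t\times\mathcal A)$. (D) The set $q_{\infty,1}(X)$ is convex, and $q_{\infty,1}(X)=q_{\infty,1}(\mathcal V)$. -/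

import Mathlib

open MeasureTheory ProbabilityTheory
open scoped ENNReal NNReal

noncomputable section

namespace TeamPOMDP

open Finset Preorder

universe uS uC uO uA

/-! Time steps `1, 2, 3, …` are represented by `t = 0, 1, 2, …`; the `N` agents by `Fin N`. -/

section Spaces

variable {N : ℕ}

/-- Joint actions `𝒜 = 𝒜¹ × ⋯ × 𝒜ᴺ`. -/
abbrev JointAct (A : Fin N → Type uA) := ∀ n, A n

/-- Joint observations `𝒪 = 𝒪⁰ × 𝒪¹ × ⋯ × 𝒪ᴺ`; the component `𝒪⁰` is common. -/
abbrev JointObs (O₀ : Type uC) (O : Fin N → Type uO) := O₀ × (∀ n, O n)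

/-- Private histories of agent `n`: her private observations up to and including time `t` and her
own actions before time `t`. -/
abbrev PrivHist (O : Fin N → Type uO) (A : Fin N → Type uA) (t : ℕ) (n : Fin N) :=
  (Fin (t + 1) → O n) × (Fin t → A n)

/-- Joint histories: all observations up to and including time `t`, all actions before. -/
abbrev JointHist (O₀ : Type uC) (O : Fin N → Type uO) (A : Fin N → Type uA) (t : ℕ) :=
  (Fin (t + 1) → JointObs O₀ O) × (Fin t → JointAct A)

/-- Prescriptions at time `t`: one map from private histories to actions for each agent. -/
def Presc (O : Fin N → Type uO) (A : Fin N → Type uA) (t : ℕ) :=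
  ∀ n, PrivHist O A t n → A n

/-- Prescriptions form a finite discrete space (for finite spaces of observations and actions). -/
instance (O : Fin N → Type uO) (A : Fin N → Type uA) (t : ℕ) : TopologicalSpace (Presc O A t) := ⊥
instance (O : Fin N → Type uO) (A : Fin N → Type uA) (t : ℕ) :
    DiscreteTopology (Presc O A t) := ⟨rfl⟩
instance (O : Fin N → Type uO) (A : Fin N → Type uA) (t : ℕ) : MeasurableSpace (Presc O A t) := ⊤
instance (O : Fin N → Type uO) (A : Fin N → Type uA) (t : ℕ) :
    DiscreteMeasurableSpace (Presc O A t) := ⟨fun _ => trivial⟩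
instance (O : Fin N → Type uO) (A : Fin N → Type uA) (t : ℕ) [∀ n, Finite (O n)]
    [∀ n, Finite (A n)] : Finite (Presc O A t) :=
  inferInstanceAs (Finite (∀ n, PrivHist O A t n → A n))

/-- Prescription-observation histories of the coordinator: the common observations up to and
including time `t`, and the prescriptions issued before time `t`. -/
abbrev CoordHist (O₀ : Type uC) (O : Fin N → Type uO) (A : Fin N → Type uA) (t : ℕ) :=
  (Fin (t + 1) → O₀) × (∀ s : Fin t, Presc O A s)

/-- What happens in one time step: a state and a joint observation, then a prescription and
a joint action. -/
abbrev Step (S : Type uS) (O₀ : Type uC) (O : Fin N → Type uO) (A : Fin N → Type uA) (t : ℕ) :=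
  (S × JointObs O₀ O) × (Presc O A t × JointAct A)

/-- Infinite trajectories of the coordinated system. -/
abbrev Traj (S : Type uS) (O₀ : Type uC) (O : Fin N → Type uO) (A : Fin N → Type uA) :=
  ∀ t, Step S O₀ O A t

/-- The data available when the prescription and the action at time `t` are determined. -/
abbrev Info (O₀ : Type uC) (O : Fin N → Type uO) (A : Fin N → Type uA) (t : ℕ) :=
  JointHist O₀ O A t × (∀ s : Fin t, Presc O A s)

variable {S : Type uS} {O₀ : Type uC} {O : Fin N → Type uO} {A : Fin N → Type uA}

/-- The part of a joint history that agent `n` knows privately. -/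
def privPart {t : ℕ} (h : JointHist O₀ O A t) (n : Fin N) : PrivHist O A t n :=
  (fun i => (h.1 i).2 n, fun s => h.2 s n)

/-- The part of the available data that the coordinator knows. -/
def coordPart {t : ℕ} (i : Info O₀ O A t) : CoordHist O₀ O A t :=
  (fun s => (i.1.1 s).1, i.2)

/-- The joint action when every agent applies her prescription to her private history. -/
def Presc.act {t : ℕ} (γ : Presc O A t) (h : JointHist O₀ O A t) : JointAct A :=
  fun n => γ n (privPart h n)

/-- The data available at the first time step. -/
def firstInfo (o : JointObs O₀ O) : Info O₀ O A 0 :=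
  ((fun _ => o, Fin.elim0), fun s => s.elim0)

/-- The data available at time `t + 1`, given the past and the new joint observation. -/
def nextInfo {t : ℕ} (x : ∀ i : Iic t, Step S O₀ O A i) (o : JointObs O₀ O) :
    Info O₀ O A (t + 1) :=
  ((Fin.snoc (α := fun _ => JointObs O₀ O)
      (fun i : Fin (t + 1) => (x ⟨i, mem_Iic.2 (Nat.lt_succ_iff.1 i.2)⟩).1.2) o,
    fun i : Fin (t + 1) => (x ⟨i, mem_Iic.2 (Nat.lt_succ_iff.1 i.2)⟩).2.2),
   fun i : Fin (t + 1) => (x ⟨i, mem_Iic.2 (Nat.lt_succ_iff.1 i.2)⟩).2.1)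

/-- The prescription-observation history at time `t` along a trajectory. -/
def Traj.coordHist (ω : Traj S O₀ O A) (t : ℕ) : CoordHist O₀ O A t :=
  (fun i => (ω i).1.2.1, fun s => (ω s).2.1)

/-- The prescription at time `t` along a trajectory. -/
def Traj.presc (ω : Traj S O₀ O A) (t : ℕ) : Presc O A t := (ω t).2.1

/-- The joint history at time `t` along a trajectory. -/
def Traj.jointHist (ω : Traj S O₀ O A) (t : ℕ) : JointHist O₀ O A t :=
  (fun i => (ω i).1.2, fun s => (ω s).2.2)

/-- The joint action at time `t` along a trajectory. -/
def Traj.action (ω : Traj S O₀ O A) (t : ℕ) : JointAct A := (ω t).2.2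

/-- The time steps of a problem with horizon `T`, which may be infinite. -/
abbrev Times (T : ℕ∞) := {t : ℕ // (t : ℕ∞) < T}

/-- The disjoint union over `t` of (prescription-observation history, prescription) pairs,
a countable discrete space. -/
def CoordPairs (O₀ : Type uC) (O : Fin N → Type uO) (A : Fin N → Type uA) (T : ℕ∞) :=
  Σ t : Times T, CoordHist O₀ O A t × Presc O A t

instance (T : ℕ∞) : TopologicalSpace (CoordPairs O₀ O A T) := ⊥
instance (T : ℕ∞) : DiscreteTopology (CoordPairs O₀ O A T) := ⟨rfl⟩
instance (T : ℕ∞) : MeasurableSpace (CoordPairs O₀ O A T) := ⊤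
instance (T : ℕ∞) : DiscreteMeasurableSpace (CoordPairs O₀ O A T) := ⟨fun _ => trivial⟩

/-- The disjoint union over `t` of (joint history, joint action) pairs, a countable discrete
space. -/
def JointPairs (O₀ : Type uC) (O : Fin N → Type uO) (A : Fin N → Type uA) (T : ℕ∞) :=
  Σ t : Times T, JointHist O₀ O A t × JointAct A

instance (T : ℕ∞) : TopologicalSpace (JointPairs O₀ O A T) := ⊥
instance (T : ℕ∞) : DiscreteTopology (JointPairs O₀ O A T) := ⟨rfl⟩
instance (T : ℕ∞) : MeasurableSpace (JointPairs O₀ O A T) := ⊤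
instance (T : ℕ∞) : DiscreteMeasurableSpace (JointPairs O₀ O A T) := ⟨fun _ => trivial⟩

/-- The point `(t, h, γ)` of the disjoint union. -/
def CoordPairs.mk {T : ℕ∞} (t : Times T) (p : CoordHist O₀ O A t × Presc O A t) :
    CoordPairs O₀ O A T := Sigma.mk t p

/-- The point `(t, h, a)` of the disjoint union. -/
def JointPairs.mk {T : ℕ∞} (t : Times T) (p : JointHist O₀ O A t × JointAct A) :
    JointPairs O₀ O A T := Sigma.mk t p

/-- The point of the disjoint union at which the trajectory `ω` passes at time `t`. -/
def Traj.coordPair {T : ℕ∞} (t : Times T) (ω : Traj S O₀ O A) : CoordPairs O₀ O A T :=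
  CoordPairs.mk t (Traj.coordHist ω t, Traj.presc ω t)

/-- The point of the disjoint union at which the trajectory `ω` passes at time `t`. -/
def Traj.jointPair {T : ℕ∞} (t : Times T) (ω : Traj S O₀ O A) : JointPairs O₀ O A T :=
  JointPairs.mk t (Traj.jointHist ω t, Traj.action ω t)

end Spaces

/-- The data of the decision problem that drive the dynamics: the transition law `𝒫_tr`, where
`trans (s, a)` is the joint law of the next state and joint observation given the current state
and joint action, and the law `P₁` of the initial state and joint observation. -/
structure Model {N : ℕ} (S : Type uS) (O₀ : Type uC) (O : Fin N → Type uO) (A : Fin N → Type uA)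
    [MeasurableSpace S] [MeasurableSpace O₀] [∀ n, MeasurableSpace (O n)]
    [∀ n, MeasurableSpace (A n)] where
  trans : Kernel (S × JointAct A) (S × JointObs O₀ O)
  init : Measure (S × JointObs O₀ O)
  trans_markov : IsMarkovKernel trans
  init_prob : IsProbabilityMeasure init

/-- The choices of the search space `X`: the behavioral coordination policies `𝒱`, the mixtures
`M₁(𝒱)`, and the mixtures `M₁(𝒱_pure)` of pure coordination policies. -/
inductive SearchSpace
  | behavioral
  | mixtures
  | pureMixtures

/-- Total mass `m(T, α)`, the sum of `α ^ (t - 1)` over the time steps `1 ≤ t ≤ T`. -/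
def totalMass (T : ℕ∞) (α : ℝ≥0) : ℝ≥0∞ := ∑' t : Times T, (α : ℝ≥0∞) ^ (t : ℕ)

/-- The admissible horizons and discount factors: `T ∈ ℕ ∪ {∞}`, `α ∈ (0, 1]`, but not
`(T, α) = (∞, 1)`. -/
def Admissible (T : ℕ∞) (α : ℝ≥0) : Prop := 0 < α ∧ α ≤ 1 ∧ ¬ (T = ⊤ ∧ α = 1)

theorem Admissible.totalMass_lt_top {T : ℕ∞} {α : ℝ≥0} (h : Admissible T α) :
    totalMass T α < ∞ := by
  rcases lt_or_eq_of_le h.2.1 with h1 | h1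
  · refine lt_of_le_of_lt
      (ENNReal.tsum_comp_le_tsum_of_injective Subtype.val_injective
        (fun t : ℕ => (α : ℝ≥0∞) ^ t)) ?_
    rw [ENNReal.tsum_geometric, ENNReal.inv_lt_top, tsub_pos_iff_lt]
    exact_mod_cast h1
  · have hT : T ≠ ⊤ := fun hT => h.2.2 ⟨hT, h1⟩
    lift T to ℕ using hT
    have : Finite (Times (T : ℕ∞)) :=
      Set.Finite.subset (Set.finite_Iio T) (fun t ht => by
        have : ((t : ℕ) : ℕ∞) < (T : ℕ∞) := ht
        exact_mod_cast this)
    have := Fintype.ofFinite (Times (T : ℕ∞))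
    rw [totalMass, tsum_fintype]
    exact ENNReal.sum_lt_top.2 fun t _ => ENNReal.pow_lt_top ENNReal.coe_lt_top

section Policies

variable {N : ℕ} (O₀ : Type uC) (O : Fin N → Type uO) (A : Fin N → Type uA)

/-- Behavioral coordination policies. All histories and prescriptions range over finite sets, so
every map is measurable. -/
def Policy := ∀ t, CoordHist O₀ O A t → ProbabilityMeasure (Presc O A t)

/-- The product of the topologies of weak convergence. -/
instance : TopologicalSpace (Policy O₀ O A) :=
  inferInstanceAs (TopologicalSpace
    (∀ t, CoordHist O₀ O A t → ProbabilityMeasure (Presc O A t)))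

instance : MeasurableSpace (Policy O₀ O A) := borel _

instance : BorelSpace (Policy O₀ O A) := ⟨rfl⟩

variable {O₀ O A} in
theorem measurable_apply_policy (t : ℕ) (h : CoordHist O₀ O A t) :
    Measurable fun v : Policy O₀ O A => (v t h : Measure (Presc O A t)) := by
  refine Measure.measurable_of_measurable_coe _ fun s _ => ?_
  have hc : Continuous fun v : Policy O₀ O A => v t h :=
    (continuous_apply h).comp (continuous_apply (A := fun t => CoordHist O₀ O A t →
      ProbabilityMeasure (Presc O A t)) t)
  refine Continuous.measurable (continuous_iff_continuousAt.2 fun v => ?_)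
  refine ProbabilityMeasure.tendsto_measure_of_null_frontier_of_tendsto' hc.continuousAt ?_
  simp

/-- Pure coordination policies: every prescription is generated deterministically. -/
def purePolicies : Set (Policy O₀ O A) :=
  {v | ∀ t h, ∃ γ, (v t h : Measure (Presc O A t)) = Measure.dirac γ}

/-- The elements of the search space `X`. Measures on `𝒱_pure` are the measures on `𝒱` that are
concentrated on it. -/
def SearchSpace.Elem : SearchSpace → Type (max uC uO uA)
  | .behavioral => Policy O₀ O A
  | .mixtures => ProbabilityMeasure (Policy O₀ O A)
  | .pureMixtures => {ν : ProbabilityMeasure (Policy O₀ O A) //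
      (ν : Measure (Policy O₀ O A)) (purePolicies O₀ O A) = 1}

/-- The product topology on `𝒱`, the topology of weak convergence on `M₁(𝒱)`, and the subspace
topology on `M₁(𝒱_pure)`. -/
instance : (X : SearchSpace) → TopologicalSpace (X.Elem O₀ O A)
  | .behavioral => inferInstanceAs (TopologicalSpace (Policy O₀ O A))
  | .mixtures => inferInstanceAs (TopologicalSpace (ProbabilityMeasure (Policy O₀ O A)))
  | .pureMixtures => inferInstanceAs (TopologicalSpace {ν : ProbabilityMeasure (Policy O₀ O A) //
      (ν : Measure (Policy O₀ O A)) (purePolicies O₀ O A) = 1})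

end Policies

/-- The measure of Ionescu-Tulcea depends measurably on a parameter of the kernels. -/
theorem measurable_trajMeasure {V : Type*} [MeasurableSpace V] {X : ℕ → Type*}
    [∀ n, MeasurableSpace (X n)] (μ : Kernel V (X 0)) [IsMarkovKernel μ]
    (κ : ∀ n, Kernel (V × (∀ i : Iic n, X i)) (X (n + 1))) [∀ n, IsMarkovKernel (κ n)] :
    Measurable fun v => Kernel.trajMeasure (μ v) fun n => (κ n).sectR v := by
  have key : ∀ n, Measurable fun v =>
      (Kernel.trajMeasure (μ v) fun n => (κ n).sectR v).map (frestrictLe n) := by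
    intro n
    induction n with
    | zero =>
      have h : ∀ v, (Kernel.trajMeasure (μ v) fun n => (κ n).sectR v).map (frestrictLe 0) =
          (μ v).map (MeasurableEquiv.piUnique fun i : Iic 0 => X i).symm := by
        intro v
        rw [Kernel.trajMeasure, Measure.map_comp _ _ (by fun_prop), Kernel.traj_map_frestrictLe,
          Kernel.partialTraj_self, Measure.id_comp]
        rfl
      simp_rw [h]
      exact (Measure.measurable_map _ (MeasurableEquiv.measurable _)).comp μ.measurable
    | succ n ih =>
      let Q : Kernel V (∀ i : Iic n, X i) := ⟨_, ih⟩
      have : IsMarkovKernel Q := ⟨fun v => Measure.isProbabilityMeasure_map (by fun_prop)⟩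
      have h : ∀ v, (Kernel.trajMeasure (μ v) fun n => (κ n).sectR v).map (frestrictLe (n + 1)) =
          ((Q ⊗ₖ κ n) v).map
            (IicProdIoc n (n + 1) ∘ Prod.map id (MeasurableEquiv.piSingleton (X := X) n)) := by
        intro v
        rw [Kernel.compProd_apply_eq_compProd_sectR]
        change _ = Measure.map _ (Measure.map _ _ ⊗ₘ _)
        rw [Kernel.map_frestrictLe_trajMeasure_compProd_eq_map_trajMeasure (a := n)
          (κ := fun n => (κ n).sectR v), Measure.map_map]
        · congr 1
          ext x i
          simp only [Function.comp, IicProdIoc, Prod.map, id]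
          split_ifs with hi
          · rfl
          · obtain ⟨i, hi'⟩ := i
            obtain rfl : i = n + 1 := by
              have := mem_Iic.1 hi'
              simp at hi
              omega
            rfl
        · exact measurable_IicProdIoc.comp (measurable_id.prodMap (MeasurableEquiv.measurable _))
        · fun_prop
      simp_rw [h]
      exact (Measure.measurable_map _ (measurable_IicProdIoc.comp
        (measurable_id.prodMap (MeasurableEquiv.measurable _)))).comp (Kernel.measurable _)
  refine Measurable.measure_of_isPiSystem_of_isProbabilityMeasure
    generateFrom_measurableCylinders.symm isPiSystem_measurableCylinders fun s hs => ?_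
  rw [measurableCylinders_nat] at hs
  simp only [Set.mem_iUnion, Set.mem_singleton_iff] at hs
  obtain ⟨a, B, hB, rfl⟩ := hs
  have h : ∀ v, (Kernel.trajMeasure (μ v) fun n => (κ n).sectR v) (cylinder (Iic a) B) =
      (Kernel.trajMeasure (μ v) fun n => (κ n).sectR v).map (frestrictLe a) B := fun v =>
    (Measure.map_apply (by fun_prop) hB).symm
  simp_rw [h]
  exact (Measure.measurable_coe hB).comp (key a)

theorem measurable_snoc {α β : Type*} [MeasurableSpace α] [MeasurableSpace β] {n : ℕ}
    {f : α → Fin n → β} {g : α → β} (hf : Measurable f) (hg : Measurable g) :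
    Measurable fun a => (Fin.snoc (α := fun _ => β) (f a) (g a) : Fin (n + 1) → β) := by
  refine measurable_pi_lambda _ fun i => ?_
  refine Fin.lastCases ?_ (fun i => ?_) i
  · simpa using hg
  · simpa using hf.eval

theorem measurable_nextInfo {N : ℕ} {S : Type uS} {O₀ : Type uC} {O : Fin N → Type uO}
    {A : Fin N → Type uA} [MeasurableSpace S] [MeasurableSpace O₀] [∀ n, MeasurableSpace (O n)]
    [∀ n, MeasurableSpace (A n)] (t : ℕ) :
    Measurable fun p : (∀ i : Iic t, Step S O₀ O A i) × JointObs O₀ O => nextInfo p.1 p.2 := by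
  refine ((measurable_snoc ?_ measurable_snd).prodMk ?_).prodMk ?_ <;> fun_prop

section Dynamics

variable {N : ℕ} {S : Type uS} {O₀ : Type uC} {O : Fin N → Type uO} {A : Fin N → Type uA}
  [MeasurableSpace S]
  [Finite O₀] [MeasurableSpace O₀] [DiscreteMeasurableSpace O₀]
  [∀ n, Finite (O n)] [∀ n, MeasurableSpace (O n)] [∀ n, DiscreteMeasurableSpace (O n)]
  [∀ n, Finite (A n)] [∀ n, MeasurableSpace (A n)] [∀ n, DiscreteMeasurableSpace (A n)]

/-- At time `t`, given the available data, the coordinator draws a prescription from her policy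
and all agents apply it to their private histories. -/
def decision (t : ℕ) : Kernel (Policy O₀ O A × Info O₀ O A t) (Presc O A t × JointAct A) where
  toFun p := (p.1 t (coordPart p.2) : Measure (Presc O A t)).map fun γ => (γ, Presc.act γ p.2.1)
  measurable' := by
    refine measurable_from_prod_countable_left fun i => ?_
    exact (Measure.measurable_map _
      (Measurable.of_discrete (f := fun γ : Presc O A t => (γ, Presc.act γ i.1)))).comp
      (measurable_apply_policy t (coordPart i))

instance (t : ℕ) : IsMarkovKernel (decision (O₀ := O₀) (O := O) (A := A) t) :=
  ⟨fun _ => Measure.isProbabilityMeasure_map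
    (Measurable.of_discrete (f := fun γ : Presc O A t => (γ, Presc.act γ _))).aemeasurable⟩

namespace Model

variable (M : Model S O₀ O A)

instance : IsMarkovKernel M.trans := M.trans_markov
instance : IsProbabilityMeasure M.init := M.init_prob

/-- The first step: the initial state and joint observation have law `P₁`, then the decision. -/
def firstStep : Kernel (Policy O₀ O A) (Step S O₀ O A 0) :=
  Kernel.const _ M.init ⊗ₖ
    (decision 0).comap (fun p : Policy O₀ O A × (S × JointObs O₀ O) => (p.1, firstInfo p.2.2))
      (by
        have : Measurable (firstInfo : JointObs O₀ O → Info O₀ O A 0) := .of_discrete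
        fun_prop)

/-- Step `t + 1` given the past: the next state and joint observation are drawn from the transition
law at the current state and joint action, then the decision. -/
def nextStep (t : ℕ) :
    Kernel (Policy O₀ O A × (∀ i : Iic t, Step S O₀ O A i)) (Step S O₀ O A (t + 1)) :=
  M.trans.comap
      (fun p : Policy O₀ O A × (∀ i : Iic t, Step S O₀ O A i) =>
        ((p.2 ⟨t, mem_Iic.2 le_rfl⟩).1.1, (p.2 ⟨t, mem_Iic.2 le_rfl⟩).2.2))
      (by fun_prop) ⊗ₖ
    (decision (t + 1)).comap
      (fun p : (Policy O₀ O A × (∀ i : Iic t, Step S O₀ O A i)) × (S × JointObs O₀ O) =>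
        (p.1.1, nextInfo p.1.2 p.2.2))
      (by
        exact (measurable_fst.comp measurable_fst).prodMk ((measurable_nextInfo t).comp
          ((measurable_snd.comp measurable_fst).prodMk (measurable_snd.comp measurable_snd))))

instance : IsMarkovKernel M.firstStep := by unfold firstStep; infer_instance
instance (t : ℕ) : IsMarkovKernel (M.nextStep t) := by unfold nextStep; infer_instance

/-- The law `ℙ_v` of the trajectory under the policy `v`, by the theorem of Ionescu-Tulcea. -/
def policyLaw (v : Policy O₀ O A) : Measure (Traj S O₀ O A) :=
  Kernel.trajMeasure (M.firstStep v) fun t => (M.nextStep t).sectR v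

instance policyLaw_prob (v : Policy O₀ O A) : IsProbabilityMeasure (M.policyLaw v) := by
  unfold policyLaw; infer_instance

theorem measurable_policyLaw : Measurable M.policyLaw :=
  measurable_trajMeasure M.firstStep M.nextStep

/-- `v ↦ ℙ_v` as a kernel. -/
def policyKernel : Kernel (Policy O₀ O A) (Traj S O₀ O A) := ⟨M.policyLaw, M.measurable_policyLaw⟩

instance : IsMarkovKernel M.policyKernel := ⟨fun v => inferInstanceAs
  (IsProbabilityMeasure (M.policyLaw v))⟩

/-- The joint law of the policy and the trajectory under the mixture `ν`: the policy is drawn from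
`ν` before the first time step. -/
def mixtureLaw (ν : ProbabilityMeasure (Policy O₀ O A)) :
    Measure (Policy O₀ O A × Traj S O₀ O A) :=
  (ν : Measure (Policy O₀ O A)) ⊗ₘ M.policyKernel

/-- The law `ℙ_x` of the trajectory under an element `x` of the search space. -/
def law : (X : SearchSpace) → X.Elem O₀ O A → Measure (Traj S O₀ O A)
  | .behavioral => fun v => M.policyLaw v
  | .mixtures => fun ν => (M.mixtureLaw ν).snd
  | .pureMixtures => fun ν => (M.mixtureLaw ν.1).snd

instance mixtureLaw_prob (ν : ProbabilityMeasure (Policy O₀ O A)) : IsProbabilityMeasure (M.mixtureLaw ν) := by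
  unfold mixtureLaw; infer_instance

theorem mixtureLaw_snd_prob (ν : ProbabilityMeasure (Policy O₀ O A)) :
    IsProbabilityMeasure (M.mixtureLaw ν).snd := inferInstance

instance : (X : SearchSpace) → (x : X.Elem O₀ O A) → IsProbabilityMeasure (M.law X x)
  | .behavioral, v => M.policyLaw_prob v
  | .mixtures, ν => M.mixtureLaw_snd_prob ν
  | .pureMixtures, ν => M.mixtureLaw_snd_prob ν.1

/-- The coordinator-level occupation measure: the point `(t, h, γ)` has mass `α ^ (t - 1)` times the
probability under `x` that at time `t` the prescription-observation history is `h` and the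
prescription is `γ`. -/
def coordOcc (T : ℕ∞) (α : ℝ≥0) (X : SearchSpace) (x : X.Elem O₀ O A) :
    Measure (CoordPairs O₀ O A T) :=
  Measure.sum fun t : Times T => α ^ (t : ℕ) • (M.law X x).map (Traj.coordPair t)

/-- The agent-level occupation measure: the point `(t, h, a)` has mass `α ^ (t - 1)` times the
probability under `x` that at time `t` the joint history is `h` and the joint action is `a`. -/
def jointOcc (T : ℕ∞) (α : ℝ≥0) (X : SearchSpace) (x : X.Elem O₀ O A) :
    Measure (JointPairs O₀ O A T) :=
  Measure.sum fun t : Times T => α ^ (t : ℕ) • (M.law X x).map (Traj.jointPair t)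

theorem measurable_coordPair {T : ℕ∞} (t : Times T) :
    Measurable (Traj.coordPair t : Traj S O₀ O A → CoordPairs O₀ O A T) := by
  have h : Measurable fun ω : Traj S O₀ O A => (Traj.coordHist ω t, Traj.presc ω t) := by
    unfold Traj.coordHist Traj.presc; fun_prop
  exact (Measurable.of_discrete (f := CoordPairs.mk (O₀ := O₀) (O := O) (A := A) t)).comp h

theorem measurable_jointPair {T : ℕ∞} (t : Times T) :
    Measurable (Traj.jointPair t : Traj S O₀ O A → JointPairs O₀ O A T) := by
  have h : Measurable fun ω : Traj S O₀ O A => (Traj.jointHist ω t, Traj.action ω t) := by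
    unfold Traj.jointHist Traj.action; fun_prop
  exact (Measurable.of_discrete (f := JointPairs.mk (O₀ := O₀) (O := O) (A := A) t)).comp h

theorem coordOcc_univ (T : ℕ∞) (α : ℝ≥0) (X : SearchSpace) (x : X.Elem O₀ O A) :
    M.coordOcc T α X x Set.univ = totalMass T α := by
  rw [coordOcc, Measure.sum_apply _ .univ, totalMass]
  congr 1 with t
  have := Measure.isProbabilityMeasure_map (μ := M.law X x) (measurable_coordPair t).aemeasurable
  simp [measure_univ]

theorem jointOcc_univ (T : ℕ∞) (α : ℝ≥0) (X : SearchSpace) (x : X.Elem O₀ O A) :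
    M.jointOcc T α X x Set.univ = totalMass T α := by
  rw [jointOcc, Measure.sum_apply _ .univ, totalMass]
  congr 1 with t
  have := Measure.isProbabilityMeasure_map (μ := M.law X x) (measurable_jointPair t).aemeasurable
  simp [measure_univ]

/-- For admissible `(T, α)` the coordinator-level occupation measure is finite. -/
def coordOccFinite {T : ℕ∞} {α : ℝ≥0} (h : Admissible T α) (X : SearchSpace)
    (x : X.Elem O₀ O A) : FiniteMeasure (CoordPairs O₀ O A T) :=
  ⟨M.coordOcc T α X x, ⟨(M.coordOcc_univ T α X x).trans_lt h.totalMass_lt_top⟩⟩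

/-- For admissible `(T, α)` the agent-level occupation measure is finite. -/
def jointOccFinite {T : ℕ∞} {α : ℝ≥0} (h : Admissible T α) (X : SearchSpace)
    (x : X.Elem O₀ O A) : FiniteMeasure (JointPairs O₀ O A T) :=
  ⟨M.jointOcc T α X x, ⟨(M.jointOcc_univ T α X x).trans_lt h.totalMass_lt_top⟩⟩

end Model

end Dynamics

end TeamPOMDP

end

open TeamPOMDP

noncomputable section

namespace TeamPOMDP

open Finset Preorder

set_option linter.unusedSectionVars false

universe uS uC uO uA

/-! ### Weights: the factor through which a policy acts -/

section Weights

variable {N : ℕ} {S : Type uS} {O₀ : Type uC} {O : Fin N → Type uO} {A : Fin N → Type uA}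

/-! The policy enters the law of the trajectory only as a scalar. Forget the states and fix what
else happens up to time `t`, as along `e`. The probability of this under `v` is `weight v t e * g`,
where `weight v t e` is the product of the probabilities with which `v` issues the prescriptions
along `e`, and `g` collects the initial law, the transitions and the condition that the actions are
the prescribed ones. Since the unseen state drives the transitions, the induction
(`exists_stateMeasure`) carries the law of the state on this event: it is `weight v t e` times a
measure independent of `v`. For a mixture the weight is replaced by its integral
(`exists_law_hist`).

The search spaces therefore yield the same occupation measures once they yield the same weights,
which is a form of Kuhn's theorem (`exists_searchWeight_eq`). The coordinator remembers her
observations and prescriptions, so a mixture has the weights of the behavioral policy that averages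
over the posterior law of the policy given her history. Conversely, drawing all prescriptions in
advance, independently over histories, turns a behavioral policy into a mixture of pure ones; a
trajectory visits each history at most once.

Convexity is then read off from the mixtures, whose law is affine in the mixing measure. Continuity
follows because a weight is a finite product of continuous functions of `v`, histories without
states are finite in number, and discounting makes the sum over time converge uniformly. Compactness
follows from that of `Policy`, on which all ranges are already attained. -/

/-- The restriction of a prescription-observation history to an earlier time. -/
def CoordHist.past {t : ℕ} (h : CoordHist O₀ O A t) (s : Fin t) : CoordHist O₀ O A s :=
  (fun i => h.1 ⟨i, i.2.trans (Nat.succ_lt_succ s.2)⟩, fun r => h.2 ⟨r, r.2.trans s.2⟩)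

/-- The probability that the policy `v` issues the prescriptions in `h`, when the common
observations are as in `h`. -/
def pastWeight (v : Policy O₀ O A) {t : ℕ} (h : CoordHist O₀ O A t) : ℝ≥0 :=
  ∏ s : Fin t, v s (CoordHist.past h s) {h.2 s}

/-- The probability that the policy `v` issues the prescriptions along `e` up to time `t`, when the
common observations are as along `e`. -/
def weight (v : Policy O₀ O A) (t : ℕ) (e : Traj Unit O₀ O A) : ℝ≥0 :=
  ∏ s ∈ range (t + 1), v s (Traj.coordHist e s) {Traj.presc e s}

theorem weight_zero (v : Policy O₀ O A) (e : Traj Unit O₀ O A) :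
    weight v 0 e = v 0 (Traj.coordHist e 0) {Traj.presc e 0} := by
  simp [weight]

theorem weight_succ (v : Policy O₀ O A) (t : ℕ) (e : Traj Unit O₀ O A) :
    weight v (t + 1) e =
      weight v t e * v (t + 1) (Traj.coordHist e (t + 1)) {Traj.presc e (t + 1)} :=
  prod_range_succ _ _

theorem pastWeight_coordHist_mul (v : Policy O₀ O A) (t : ℕ) (e : Traj Unit O₀ O A) :
    pastWeight v (Traj.coordHist e t) * v t (Traj.coordHist e t) {Traj.presc e t} =
      weight v t e := by
  rw [weight, prod_range_succ, prod_range]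
  rfl

theorem pastWeight_zero (v : Policy O₀ O A) (h : CoordHist O₀ O A 0) : pastWeight v h = 1 := by
  simp [pastWeight]

theorem pastWeight_succ (v : Policy O₀ O A) {t : ℕ} (h : CoordHist O₀ O A (t + 1)) :
    pastWeight v h = pastWeight v (CoordHist.past h (Fin.last t)) *
      v t (CoordHist.past h (Fin.last t)) {h.2 (Fin.last t)} := by
  rw [pastWeight, Fin.prod_univ_castSucc]
  rfl

theorem continuous_policy_apply (t : ℕ) (h : CoordHist O₀ O A t) :
    Continuous fun v : Policy O₀ O A => v t h :=
  (continuous_apply h).comp (continuous_apply (A := fun t => CoordHist O₀ O A t →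
    ProbabilityMeasure (Presc O A t)) t)

/-- Every set in a discrete space has empty frontier, so weak convergence implies convergence of its
mass. -/
theorem continuous_policy_apply_set (t : ℕ) (h : CoordHist O₀ O A t) (s : Set (Presc O A t)) :
    Continuous fun v : Policy O₀ O A => v t h s := by
  refine continuous_iff_continuousAt.2 fun v => ?_
  refine ProbabilityMeasure.tendsto_measure_of_null_frontier_of_tendsto
    (continuous_policy_apply t h).continuousAt ?_
  simp

theorem continuous_weight (t : ℕ) (e : Traj Unit O₀ O A) :
    Continuous fun v : Policy O₀ O A => weight v t e :=
  continuous_finsetProd _ fun _ _ => continuous_policy_apply_set _ _ _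

theorem continuous_pastWeight {t : ℕ} (h : CoordHist O₀ O A t) :
    Continuous fun v : Policy O₀ O A => pastWeight v h :=
  continuous_finsetProd _ fun _ _ => continuous_policy_apply_set _ _ _

theorem pastWeight_le_one (v : Policy O₀ O A) {t : ℕ} (h : CoordHist O₀ O A t) :
    pastWeight v h ≤ 1 :=
  prod_le_one' fun _ _ => ProbabilityMeasure.apply_le_one _ _

/-- The quantity through which an element of the search space influences the law of the
trajectory. -/
def searchWeight : (X : SearchSpace) → X.Elem O₀ O A → ℕ → Traj Unit O₀ O A → ℝ≥0∞
  | .behavioral => fun v t e => weight v t e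
  | .mixtures => fun (ν : ProbabilityMeasure (Policy O₀ O A)) t e =>
      ∫⁻ v, weight v t e ∂(ν : Measure (Policy O₀ O A))
  | .pureMixtures => fun ν t e => ∫⁻ v, weight v t e ∂(ν.1 : Measure (Policy O₀ O A))

end Weights

/-! ### From mixtures to behavioral policies -/

section Kuhn

variable {N : ℕ} {O₀ : Type uC} {O : Fin N → Type uO} {A : Fin N → Type uA}
  [∀ n, Finite (O n)] [∀ n, Finite (A n)]

/-- The probability under the mixture `ν` of issuing the prescriptions in `h`. -/
def mixtureWeight (ν : ProbabilityMeasure (Policy O₀ O A)) {t : ℕ} (h : CoordHist O₀ O A t) :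
    ℝ≥0∞ :=
  ∫⁻ v, pastWeight v h ∂(ν : Measure (Policy O₀ O A))

theorem mixtureWeight_ne_top (ν : ProbabilityMeasure (Policy O₀ O A)) {t : ℕ}
    (h : CoordHist O₀ O A t) : mixtureWeight ν h ≠ ∞ := by
  refine ne_top_of_le_ne_top ENNReal.one_ne_top (le_trans (lintegral_mono (g := 1) fun v => ?_)
    (by simp))
  simpa using pastWeight_le_one v h

/-- The law of the prescription at the history `h`, averaged over the posterior law of the
policy. -/
def posteriorMeasure (ν : ProbabilityMeasure (Policy O₀ O A)) {t : ℕ} (h : CoordHist O₀ O A t) :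
    Measure (Presc O A t) :=
  (mixtureWeight ν h)⁻¹ • Measure.sum fun γ : Presc O A t =>
    (∫⁻ v, pastWeight v h * v t h {γ} ∂(ν : Measure (Policy O₀ O A))) • Measure.dirac γ

theorem posteriorMeasure_apply (ν : ProbabilityMeasure (Policy O₀ O A)) {t : ℕ}
    (h : CoordHist O₀ O A t) (γ : Presc O A t) :
    posteriorMeasure ν h {γ} = (mixtureWeight ν h)⁻¹ *
      ∫⁻ v, pastWeight v h * v t h {γ} ∂(ν : Measure (Policy O₀ O A)) := by
  classical
  rw [posteriorMeasure, Measure.smul_apply, Measure.sum_apply _ (.of_discrete), smul_eq_mul,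
    tsum_eq_single γ]
  · simp
  · intro γ' h'
    simp [h']

theorem sum_prob_singleton {Y : Type*} [Fintype Y] [MeasurableSpace Y] [DiscreteMeasurableSpace Y]
    (μ : ProbabilityMeasure Y) : ∑ y, (μ {y} : ℝ≥0∞) = 1 := by
  simp_rw [ProbabilityMeasure.ennreal_coeFn_eq_coeFn_toMeasure]
  rw [sum_measure_singleton]
  simp

theorem posteriorMeasure_univ (ν : ProbabilityMeasure (Policy O₀ O A)) {t : ℕ}
    (h : CoordHist O₀ O A t) (h0 : mixtureWeight ν h ≠ 0) :
    posteriorMeasure ν h Set.univ = 1 := by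
  have := Fintype.ofFinite (Presc O A t)
  rw [posteriorMeasure, Measure.smul_apply, Measure.sum_apply _ .univ, tsum_fintype]
  simp only [Measure.smul_apply, measure_univ, smul_eq_mul, mul_one]
  rw [← lintegral_finsetSum]
  · simp_rw [← Finset.mul_sum, sum_prob_singleton, mul_one]
    exact ENNReal.inv_mul_cancel h0 (mixtureWeight_ne_top ν h)
  · intro γ _
    exact ((continuous_pastWeight h).measurable.coe_nnreal_ennreal).mul
      ((continuous_policy_apply_set t h _).measurable.coe_nnreal_ennreal)

open Classical in
/-- The behavioral policy that follows the posterior law of the prescription, and `v₀` at histories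
that the mixture does not reach. -/
def posteriorPolicy (ν : ProbabilityMeasure (Policy O₀ O A)) (v₀ : Policy O₀ O A) :
    Policy O₀ O A := fun t h =>
  if h0 : mixtureWeight ν h = 0 then v₀ t h
  else ⟨posteriorMeasure ν h, ⟨posteriorMeasure_univ ν h h0⟩⟩

theorem posteriorPolicy_of_ne (ν : ProbabilityMeasure (Policy O₀ O A)) (v₀ : Policy O₀ O A)
    {t : ℕ} (h : CoordHist O₀ O A t) (h0 : mixtureWeight ν h ≠ 0) :
    (posteriorPolicy ν v₀ t h : Measure (Presc O A t)) = posteriorMeasure ν h :=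
  congrArg _ (dif_neg h0)

/-- Bayes' rule with the denominator cleared. In this form it also holds at histories of weight
zero: there the right side is at most `mixtureWeight ν h`, so the default `v₀` is harmless. -/
theorem mixtureWeight_mul_posteriorPolicy (ν : ProbabilityMeasure (Policy O₀ O A))
    (v₀ : Policy O₀ O A) {t : ℕ} (h : CoordHist O₀ O A t) (γ : Presc O A t) :
    mixtureWeight ν h * posteriorPolicy ν v₀ t h {γ} =
      ∫⁻ v, pastWeight v h * v t h {γ} ∂(ν : Measure (Policy O₀ O A)) := by
  by_cases h0 : mixtureWeight ν h = 0
  · rw [h0, zero_mul, eq_comm, ← le_zero_iff, ← h0]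
    refine lintegral_mono fun v => mul_le_of_le_one_right' ?_
    exact ENNReal.coe_le_one_iff.2 (ProbabilityMeasure.apply_le_one (v t h) {γ})
  · rw [ProbabilityMeasure.ennreal_coeFn_eq_coeFn_toMeasure, posteriorPolicy_of_ne ν v₀ h h0,
      posteriorMeasure_apply, ← mul_assoc, ENNReal.mul_inv_cancel h0 (mixtureWeight_ne_top ν h),
      one_mul]

/-- The conditional probabilities telescope: each posterior factor turns the mixture's weight of a
history into that of its extension by one prescription. -/
theorem pastWeight_posteriorPolicy (ν : ProbabilityMeasure (Policy O₀ O A))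
    (v₀ : Policy O₀ O A) {t : ℕ} (h : CoordHist O₀ O A t) :
    (pastWeight (posteriorPolicy ν v₀) h : ℝ≥0∞) = mixtureWeight ν h := by
  induction t with
  | zero => simp [mixtureWeight, pastWeight_zero]
  | succ t ih =>
    rw [pastWeight_succ, ENNReal.coe_mul, ih, mixtureWeight_mul_posteriorPolicy, mixtureWeight]
    simp_rw [pastWeight_succ, ENNReal.coe_mul]

/-- Every mixture of behavioral coordination policies is equivalent to a behavioral one. -/
theorem exists_policy_weight_eq (ν : ProbabilityMeasure (Policy O₀ O A)) :
    ∃ v : Policy O₀ O A, ∀ t e,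
      (weight v t e : ℝ≥0∞) = ∫⁻ u, weight u t e ∂(ν : Measure (Policy O₀ O A)) := by
  -- No action space is assumed nonempty; that some policy exists follows from `ν` having mass one.
  obtain ⟨v₀⟩ := ν.nonempty
  refine ⟨posteriorPolicy ν v₀, fun t e => ?_⟩
  simp_rw [← pastWeight_coordHist_mul, ENNReal.coe_mul]
  rw [pastWeight_posteriorPolicy, mixtureWeight_mul_posteriorPolicy]

/-- Tychonoff's theorem, with factors the probability measures on a finite discrete space. -/
instance : CompactSpace (Policy O₀ O A) :=
  inferInstanceAs (CompactSpace
    (∀ t, CoordHist O₀ O A t → ProbabilityMeasure (Presc O A t)))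

end Kuhn

/-! ### From behavioral policies to mixtures of pure ones -/

section Pure

variable {N : ℕ} {O₀ : Type uC} {O : Fin N → Type uO} {A : Fin N → Type uA}
  [Finite O₀] [∀ n, Finite (O n)] [∀ n, Finite (A n)]

/-- The pure policy that issues the prescriptions `g`. -/
def purePolicy (g : ∀ p : Σ t, CoordHist O₀ O A t, Presc O A p.1) : Policy O₀ O A :=
  fun t h => diracProba (g ⟨t, h⟩)

theorem purePolicy_mem (g : ∀ p : Σ t, CoordHist O₀ O A t, Presc O A p.1) :
    purePolicy g ∈ purePolicies O₀ O A := fun t h => ⟨g ⟨t, h⟩, rfl⟩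

theorem continuous_purePolicy : Continuous (purePolicy (O₀ := O₀) (O := O) (A := A)) :=
  continuous_pi fun t => continuous_pi fun h =>
    continuous_diracProba.comp (continuous_apply (⟨t, h⟩ : Σ t, CoordHist O₀ O A t))

theorem measurable_purePolicy : Measurable (purePolicy (O₀ := O₀) (O := O) (A := A)) :=
  continuous_purePolicy.measurable

/-- The pure policy whose prescriptions are drawn beforehand, independently over all histories,
from the policy `v`. -/
def pureMixture (v : Policy O₀ O A) : ProbabilityMeasure (Policy O₀ O A) :=
  ⟨(Measure.infinitePi fun p : Σ t, CoordHist O₀ O A t =>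
      (v p.1 p.2 : Measure (Presc O A p.1))).map purePolicy,
    Measure.isProbabilityMeasure_map measurable_purePolicy.aemeasurable⟩

theorem pureMixture_pure (v : Policy O₀ O A) :
    (pureMixture v : Measure (Policy O₀ O A)) (purePolicies O₀ O A) = 1 := by
  refine le_antisymm prob_le_one ?_
  -- This inequality holds for arbitrary sets, so measurability of `purePolicies` is not needed.
  refine le_trans ?_ (Measure.le_map_apply measurable_purePolicy.aemeasurable _)
  rw [Set.eq_univ_of_forall (s := purePolicy ⁻¹' purePolicies O₀ O A) purePolicy_mem, measure_univ]

/-- Every behavioral coordination policy is equivalent to a mixture of pure ones. -/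
theorem lintegral_weight_pureMixture (v : Policy O₀ O A) (t : ℕ) (e : Traj Unit O₀ O A) :
    ∫⁻ u, weight u t e ∂(pureMixture v : Measure (Policy O₀ O A)) = weight v t e := by
  classical
  let c : ℕ → Σ t, CoordHist O₀ O A t := fun s => ⟨s, Traj.coordHist e s⟩
  -- The histories met along `e` are distinct because they belong to distinct times, so the draws at
  -- them are independent.
  have hc : Function.Injective c := fun s s' h => congrArg Sigma.fst h
  -- A pure policy has weight 0 or 1, so the integral becomes the product probability of a box with
  -- finitely many constrained coordinates.
  have hw : ∀ g : ∀ p : Σ t, CoordHist O₀ O A t, Presc O A p.1,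
      (weight (purePolicy g) t e : ℝ≥0∞) =
        (Set.pi ((range (t + 1)).image c : Set (Σ t, CoordHist O₀ O A t))
          fun p => {Traj.presc e p.1}).indicator 1 g := by
    intro g
    rw [weight, ENNReal.ofNNReal_finsetProd]
    simp_rw [ProbabilityMeasure.ennreal_coeFn_eq_coeFn_toMeasure, purePolicy,
      diracProba_toMeasure_apply]
    simp only [Set.indicator_apply, Pi.one_apply, Set.mem_singleton_iff]
    rw [Finset.prod_boole]
    refine if_congr ?_ rfl rfl
    simp [Set.mem_pi, c]
  change ∫⁻ u, weight u t e ∂(Measure.map purePolicy _) = _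
  rw [lintegral_map (continuous_weight t e).measurable.coe_nnreal_ennreal measurable_purePolicy]
  simp_rw [hw]
  rw [lintegral_indicator_one, Measure.infinitePi_pi _ (fun _ _ => .of_discrete),
    Finset.prod_image hc.injOn, weight, ENNReal.ofNNReal_finsetProd]
  · simp_rw [ProbabilityMeasure.ennreal_coeFn_eq_coeFn_toMeasure]
    rfl
  · exact MeasurableSet.pi (Finset.countable_toSet _) fun _ _ => .of_discrete

/-- All search spaces realize the same weights. -/
theorem exists_searchWeight_eq (X Y : SearchSpace) (x : X.Elem O₀ O A) :
    ∃ y : Y.Elem O₀ O A, searchWeight Y y = searchWeight X x := by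
  have h1 : ∃ v : Policy O₀ O A, searchWeight .behavioral v = searchWeight X x := by
    cases X with
    | behavioral => exact ⟨x, rfl⟩
    | mixtures =>
      obtain ⟨v, hv⟩ := exists_policy_weight_eq x
      exact ⟨v, by ext t e; exact hv t e⟩
    | pureMixtures =>
      obtain ⟨v, hv⟩ := exists_policy_weight_eq x.1
      exact ⟨v, by ext t e; exact hv t e⟩
  obtain ⟨v, hv⟩ := h1
  rw [← hv]
  cases Y with
  | behavioral => exact ⟨v, rfl⟩
  | mixtures => exact ⟨pureMixture v, by ext t e; exact lintegral_weight_pureMixture v t e⟩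
  | pureMixtures =>
    exact ⟨⟨pureMixture v, pureMixture_pure v⟩, by
      ext t e; exact lintegral_weight_pureMixture v t e⟩

end Pure

/-! ### Forgetting the states -/

section Forget

variable {N : ℕ} {S : Type uS} {O₀ : Type uC} {O : Fin N → Type uO} {A : Fin N → Type uA}

/-- A time step without the state. -/
def Step.forget {t : ℕ} (y : Step S O₀ O A t) : Step Unit O₀ O A t := (((), y.1.2), y.2)

/-- A trajectory without the states. -/
def Traj.forget (ω : Traj S O₀ O A) : Traj Unit O₀ O A := fun t => Step.forget (ω t)

/-- The available data at time `t` along a trajectory. -/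
def Traj.info (ω : Traj S O₀ O A) (t : ℕ) : Info O₀ O A t :=
  (Traj.jointHist ω t, fun s => Traj.presc ω s)

theorem coordPart_info (ω : Traj S O₀ O A) (t : ℕ) :
    coordPart (Traj.info ω t) = Traj.coordHist ω t := rfl

theorem firstInfo_eq_info (ω : Traj S O₀ O A) : firstInfo (ω 0).1.2 = Traj.info ω 0 := by
  refine Prod.ext (Prod.ext ?_ ?_) ?_
  · funext i
    rw [Fin.fin_one_eq_zero i]
    rfl
  · funext i
    exact i.elim0
  · funext i
    exact i.elim0

theorem nextInfo_eq_info (ω : Traj S O₀ O A) (t : ℕ) :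
    nextInfo (frestrictLe t ω) (ω (t + 1)).1.2 = Traj.info ω (t + 1) := by
  refine Prod.ext (Prod.ext ?_ rfl) rfl
  funext i
  refine Fin.lastCases ?_ (fun i => ?_) i
  · simp [nextInfo, Traj.info, Traj.jointHist]
  · simp [nextInfo, Traj.info, Traj.jointHist]

/-- The data available for a decision do not involve the states. -/
theorem nextInfo_congr {t : ℕ} {x : ∀ i : Iic t, Step S O₀ O A i} {e : Traj Unit O₀ O A}
    (h : ∀ i : Iic t, Step.forget (x i) = e i) (o : JointObs O₀ O) :
    nextInfo x o = nextInfo (frestrictLe t e) o := by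
  have : frestrictLe t e = fun i => Step.forget (x i) := funext fun i => (h i).symm
  rw [this]
  rfl

/-- The trajectories that agree with `e` up to time `t`, except for the states. -/
def agreeSet (S : Type uS) (t : ℕ) (e : Traj Unit O₀ O A) : Set (∀ i : Iic t, Step S O₀ O A i) :=
  {x | ∀ i, Step.forget (x i) = e i}

end Forget

/-! ### Factorization of the law into weight and dynamics -/

section Factorization

variable {N : ℕ} {S : Type uS} {O₀ : Type uC} {O : Fin N → Type uO} {A : Fin N → Type uA}
  [MeasurableSpace S]
  [Finite O₀] [MeasurableSpace O₀] [DiscreteMeasurableSpace O₀]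
  [∀ n, Finite (O n)] [∀ n, MeasurableSpace (O n)] [∀ n, DiscreteMeasurableSpace (O n)]
  [∀ n, Finite (A n)] [∀ n, MeasurableSpace (A n)] [∀ n, DiscreteMeasurableSpace (A n)]

theorem measurable_forget {t : ℕ} :
    Measurable (Step.forget : Step S O₀ O A t → Step Unit O₀ O A t) := by
  unfold Step.forget; fun_prop

theorem measurableSet_agreeSet (t : ℕ) (e : Traj Unit O₀ O A) :
    MeasurableSet (agreeSet S t e) := by
  have : agreeSet S t e =
      ⋂ i : Iic t, (fun x : ∀ i : Iic t, Step S O₀ O A i => Step.forget (x i)) ⁻¹' {e i} := by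
    ext x; simp [agreeSet]
  rw [this]
  exact .iInter fun i => (measurable_forget.comp (measurable_pi_apply i)) (.of_discrete)

open Classical in
/-- Whether the actions at time `t` along `e` are those prescribed. -/
def consistency (e : Traj Unit O₀ O A) (t : ℕ) : ℝ≥0 :=
  if Presc.act (Traj.presc e t) (Traj.jointHist e t) = Traj.action e t then 1 else 0

/-- A prescription determines the joint action, so the pair along `e` carries either the whole mass
of its prescription or none. -/
theorem decision_info_apply (v : Policy O₀ O A) (e : Traj Unit O₀ O A) (t : ℕ) :
    decision t (v, Traj.info e t) {(e t).2} =
      consistency e t * v t (Traj.coordHist e t) {Traj.presc e t} := by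
  change Measure.map _ _ _ = _
  rw [Measure.map_apply .of_discrete .of_discrete,
    ProbabilityMeasure.ennreal_coeFn_eq_coeFn_toMeasure, coordPart_info, consistency]
  split_ifs with h
  · rw [ENNReal.coe_one, one_mul]
    congr 1
    ext γ
    simp only [Set.mem_preimage, Set.mem_singleton_iff, Prod.ext_iff]
    refine ⟨fun h => h.1, fun h' => ⟨h', ?_⟩⟩
    rw [h']
    exact h
  · rw [ENNReal.coe_zero, zero_mul]
    convert measure_empty (μ := (v t (Traj.coordHist e t) : Measure (Presc O A t)))
    ext γ
    simp only [Set.mem_preimage, Set.mem_singleton_iff, Prod.ext_iff, Set.mem_empty_iff_false,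
      iff_false, not_and]
    intro h' h''
    refine h ?_
    change γ = Traj.presc e t at h'
    rw [← h']
    exact h''

/-- The function on time steps that is `f` of the state if the rest of the time step is as along
`e`, and zero otherwise. -/
def stepTest (f : S → ℝ≥0∞) (e : Traj Unit O₀ O A) (t : ℕ) (y : Step S O₀ O A t) : ℝ≥0∞ :=
  ({(e t).1.2} : Set (JointObs O₀ O)).indicator 1 y.1.2 * f y.1.1 *
    ({(e t).2} : Set (Presc O A t × JointAct A)).indicator 1 y.2

theorem measurable_stepTest {f : S → ℝ≥0∞} (hf : Measurable f) (e : Traj Unit O₀ O A) (t : ℕ) :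
    Measurable (stepTest f e t) := by
  have h1 : Measurable (({(e t).1.2} : Set (JointObs O₀ O)).indicator
      (1 : JointObs O₀ O → ℝ≥0∞)) :=
    .of_discrete
  have h2 : Measurable (({(e t).2} : Set (Presc O A t × JointAct A)).indicator
      (1 : Presc O A t × JointAct A → ℝ≥0∞)) :=
    .of_discrete
  unfold stepTest
  fun_prop

/-- Isolates the policy's contribution to one time step as a constant, leaving an integrand in the
new state and observation. The same computation serves the first step and the later ones through the
choice of `I`. -/
theorem lintegral_stepTest_decision (f : S → ℝ≥0∞) (e : Traj Unit O₀ O A) (t : ℕ)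
    (v : Policy O₀ O A) (I : JointObs O₀ O → Info O₀ O A t) (hI : I (e t).1.2 = Traj.info e t)
    (b : S × JointObs O₀ O) :
    ∫⁻ c, stepTest f e t (b, c) ∂(decision t (v, I b.2)) =
      (consistency e t * v t (Traj.coordHist e t) {Traj.presc e t}) *
        (({(e t).1.2} : Set (JointObs O₀ O)).indicator 1 b.2 * f b.1) := by
  simp only [stepTest]
  rw [lintegral_const_mul _ .of_discrete, lintegral_indicator_one .of_discrete, mul_comm]
  -- At any other observation both sides vanish; this is why `I` need be known only at the
  -- observation along `e`.
  by_cases hb : b.2 = (e t).1.2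
  · rw [hb, hI, decision_info_apply]
  · simp [hb]

namespace Model

variable (M : Model S O₀ O A)

theorem lintegral_stepTest_firstStep {f : S → ℝ≥0∞} (hf : Measurable f) (e : Traj Unit O₀ O A)
    (v : Policy O₀ O A) :
    ∫⁻ y, stepTest f e 0 y ∂(M.firstStep v) =
      (consistency e 0 * v 0 (Traj.coordHist e 0) {Traj.presc e 0}) *
        ∫⁻ b, ({(e 0).1.2} : Set (JointObs O₀ O)).indicator 1 b.2 * f b.1 ∂M.init := by
  have h1 : Measurable (({(e 0).1.2} : Set (JointObs O₀ O)).indicator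
      (1 : JointObs O₀ O → ℝ≥0∞)) :=
    .of_discrete
  rw [firstStep, Kernel.lintegral_compProd _ _ _ (measurable_stepTest hf e 0),
    ← lintegral_const_mul _ (by fun_prop)]
  simp only [Kernel.const_apply, Kernel.comap_apply]
  congr 1 with b
  exact lintegral_stepTest_decision f e 0 v firstInfo (by
    rw [← firstInfo_eq_info]) b

theorem lintegral_stepTest_nextStep {f : S → ℝ≥0∞} (hf : Measurable f) (e : Traj Unit O₀ O A)
    (v : Policy O₀ O A) (t : ℕ) {x : ∀ i : Iic t, Step S O₀ O A i} (hx : x ∈ agreeSet S t e) :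
    ∫⁻ y, stepTest f e (t + 1) y ∂(M.nextStep t (v, x)) =
      (consistency e (t + 1) *
          v (t + 1) (Traj.coordHist e (t + 1)) {Traj.presc e (t + 1)}) *
        ∫⁻ b, ({(e (t + 1)).1.2} : Set (JointObs O₀ O)).indicator 1 b.2 * f b.1
          ∂(M.trans ((x ⟨t, mem_Iic.2 le_rfl⟩).1.1, Traj.action e t)) := by
  have h1 : Measurable (({(e (t + 1)).1.2} : Set (JointObs O₀ O)).indicator
      (1 : JointObs O₀ O → ℝ≥0∞)) :=
    .of_discrete
  have ha : (x ⟨t, mem_Iic.2 le_rfl⟩).2.2 = Traj.action e t :=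
    congrArg (fun y => y.2.2) (hx ⟨t, mem_Iic.2 le_rfl⟩)
  rw [nextStep, Kernel.lintegral_compProd _ _ _ (measurable_stepTest hf e (t + 1)),
    ← lintegral_const_mul _ (by fun_prop)]
  simp only [Kernel.comap_apply, ha]
  congr 1 with b
  exact lintegral_stepTest_decision f e (t + 1) v (nextInfo x) (by
    rw [nextInfo_congr hx, nextInfo_eq_info]) b

theorem forget_eq_iff {t : ℕ} (y : Step S O₀ O A t) (e : Traj Unit O₀ O A) :
    Step.forget y = e t ↔ y.1.2 = (e t).1.2 ∧ y.2 = (e t).2 :=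
  ⟨fun h => by rw [← h]; exact ⟨rfl, rfl⟩, fun h => Prod.ext (Prod.ext rfl h.1) h.2⟩

open Classical in
theorem stepTest_eq_ite (f : S → ℝ≥0∞) (e : Traj Unit O₀ O A) (t : ℕ) (y : Step S O₀ O A t) :
    stepTest f e t y = if Step.forget y = e t then f y.1.1 else 0 := by
  simp only [stepTest, forget_eq_iff, Set.indicator_apply, Set.mem_singleton_iff, Pi.one_apply]
  split_ifs <;> simp_all

theorem agree_zero_indicator (f : S → ℝ≥0∞) (e : Traj Unit O₀ O A) (ω : Traj S O₀ O A) :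
    (agreeSet S 0 e).indicator (fun x => f (x ⟨0, mem_Iic.2 le_rfl⟩).1.1) (frestrictLe 0 ω) =
      stepTest f e 0 (ω 0) := by
  classical
  rw [stepTest_eq_ite, Set.indicator_apply]
  refine if_congr ⟨fun h => h ⟨0, mem_Iic.2 le_rfl⟩, fun h i => ?_⟩ rfl rfl
  obtain ⟨i, hi⟩ := i
  obtain rfl := Nat.le_zero.1 (mem_Iic.1 hi)
  exact h

theorem frestrictLe_succ_mem_agreeSet (e : Traj Unit O₀ O A) (t : ℕ) (ω : Traj S O₀ O A) :
    frestrictLe (t + 1) ω ∈ agreeSet S (t + 1) e ↔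
      frestrictLe t ω ∈ agreeSet S t e ∧ Step.forget (ω (t + 1)) = e (t + 1) := by
  refine ⟨fun h => ⟨fun i => h ⟨i, mem_Iic.2 ((mem_Iic.1 i.2).trans t.le_succ)⟩,
    h ⟨t + 1, mem_Iic.2 le_rfl⟩⟩, fun h i => ?_⟩
  obtain ⟨i, hi⟩ := i
  rcases Nat.le_succ_iff.1 (mem_Iic.1 hi) with hi' | rfl
  · exact h.1 ⟨i, mem_Iic.2 hi'⟩
  · exact h.2

theorem agree_succ_indicator (f : S → ℝ≥0∞) (e : Traj Unit O₀ O A) (t : ℕ)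
    (ω : Traj S O₀ O A) :
    (agreeSet S (t + 1) e).indicator (fun x => f (x ⟨t + 1, mem_Iic.2 le_rfl⟩).1.1)
        (frestrictLe (t + 1) ω) =
      (agreeSet S t e).indicator 1 (frestrictLe t ω) * stepTest f e (t + 1) (ω (t + 1)) := by
  classical
  rw [stepTest_eq_ite, Set.indicator_apply, Set.indicator_apply, frestrictLe_succ_mem_agreeSet]
  by_cases h1 : frestrictLe t ω ∈ agreeSet S t e
  · simp only [h1, true_and, if_true, Pi.one_apply, one_mul]
    rfl
  · simp [h1]

theorem map_eval_zero_policyLaw (v : Policy O₀ O A) :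
    (M.policyLaw v).map (fun ω => ω 0) = M.firstStep v := by
  let r : (∀ i : Iic 0, Step S O₀ O A i) → Step S O₀ O A 0 := fun x => x ⟨0, mem_Iic.2 le_rfl⟩
  have hr : Measurable r := measurable_pi_apply _
  -- Families indexed by `Iic 0` are single values; `g` is this identification and `r` undoes it.
  obtain ⟨g, hg, hrg, h⟩ : ∃ g : Step S O₀ O A 0 → ∀ i : Iic 0, Step S O₀ O A i, Measurable g ∧
      r ∘ g = id ∧ (M.policyLaw v).map (frestrictLe 0) = (M.firstStep v).map g := by
    refine ⟨(MeasurableEquiv.piUnique fun i : Iic 0 => Step S O₀ O A i).symm,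
      MeasurableEquiv.measurable _, rfl, ?_⟩
    rw [policyLaw, Kernel.trajMeasure, Measure.map_comp _ _ (by fun_prop),
      Kernel.traj_map_frestrictLe, Kernel.partialTraj_self, Measure.id_comp]
    rfl
  change (M.policyLaw v).map (r ∘ frestrictLe 0) = _
  rw [← Measure.map_map hr (by fun_prop), h, Measure.map_map hr hg, hrg, Measure.map_id]

/-- Under every policy, the law of the state at time `t` on the event that everything else is as
along `e` is a fixed measure times the weight of the policy. -/
theorem exists_stateMeasure (e : Traj Unit O₀ O A) (t : ℕ) :
    ∃ G : Measure S, IsFiniteMeasure G ∧ ∀ (v : Policy O₀ O A) (f : S → ℝ≥0∞), Measurable f →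
      ∫⁻ ω, (agreeSet S t e).indicator (fun x => f (x ⟨t, mem_Iic.2 le_rfl⟩).1.1)
        (frestrictLe t ω) ∂(M.policyLaw v) = weight v t e * ∫⁻ s, f s ∂G := by
  induction t with
  | zero =>
    -- `G` is the law of the initial state on the event that the first observation is as along `e`,
    -- or zero if the action along `e` is not the prescribed one.
    refine ⟨consistency e 0 • (M.init.restrict (Prod.snd ⁻¹' {(e 0).1.2})).map Prod.fst,
      inferInstance, fun v f hf => ?_⟩
    have hm : MeasurableSet (Prod.snd ⁻¹' {(e 0).1.2} : Set (S × JointObs O₀ O)) :=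
      measurable_snd .of_discrete
    simp_rw [agree_zero_indicator]
    rw [← lintegral_map (f := stepTest f e 0) (g := fun ω : Traj S O₀ O A => ω 0)
      (measurable_stepTest hf e 0) (measurable_pi_apply 0), map_eval_zero_policyLaw,
      lintegral_stepTest_firstStep M hf, lintegral_smul_measure, lintegral_map hf measurable_fst,
      ← lintegral_indicator hm, weight_zero, mul_comm (consistency e 0 : ℝ≥0∞), mul_assoc]
    congr 2
    refine lintegral_congr fun b => ?_
    by_cases hb : b.2 = (e 0).1.2 <;> simp [hb]
  | succ t ih =>
    obtain ⟨G, hG, ih⟩ := ih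
    -- On the event the last action is that along `e`, so the transition depends on the state alone.
    -- The new `G` moves the old one by `κ`, keeps the prescribed observation and projects to the
    -- state.
    let κ : Kernel S (S × JointObs O₀ O) :=
      M.trans.comap (fun s => (s, Traj.action e t)) (by fun_prop)
    refine ⟨consistency e (t + 1) •
      ((G.bind κ).restrict (Prod.snd ⁻¹' {(e (t + 1)).1.2})).map Prod.fst,
      inferInstance, fun v f hf => ?_⟩
    have hm : MeasurableSet (Prod.snd ⁻¹' {(e (t + 1)).1.2} : Set (S × JointObs O₀ O)) :=
      measurable_snd .of_discrete
    have h1 : Measurable (({(e (t + 1)).1.2} : Set (JointObs O₀ O)).indicator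
      (1 : JointObs O₀ O → ℝ≥0∞)) :=
      .of_discrete
    have hF : Measurable fun b : S × JointObs O₀ O =>
      ({(e (t + 1)).1.2} : Set (JointObs O₀ O)).indicator 1 b.2 * f b.1 := by fun_prop
    have hind : Measurable ((agreeSet S t e).indicator
        (1 : (∀ i : Iic t, Step S O₀ O A i) → ℝ≥0∞)) :=
      measurable_one.indicator (measurableSet_agreeSet t e)
    have hs := measurable_stepTest hf e (t + 1)
    simp_rw [agree_succ_indicator]
    rw [← lintegral_map
        (f := fun p : (∀ i : Iic t, Step S O₀ O A i) × Step S O₀ O A (t + 1) =>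
          (agreeSet S t e).indicator 1 p.1 * stepTest f e (t + 1) p.2)
        (g := fun ω : Traj S O₀ O A => (frestrictLe t ω, ω (t + 1))) (by fun_prop) (by fun_prop),
      policyLaw, ← Kernel.map_frestrictLe_trajMeasure_compProd_eq_map_trajMeasure,
      Measure.lintegral_compProd (by fun_prop)]
    -- Off `agreeSet` both sides vanish. On it the decision at time `t + 1` contributes a constant,
    -- and what remains is a function of the last state.
    have hx : ∀ x : ∀ i : Iic t, Step S O₀ O A i,
        ∫⁻ y, (agreeSet S t e).indicator 1 x * stepTest f e (t + 1) y
          ∂((M.nextStep t).sectR v x) =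
        (consistency e (t + 1) *
          v (t + 1) (Traj.coordHist e (t + 1)) {Traj.presc e (t + 1)}) *
        (agreeSet S t e).indicator (fun x => ∫⁻ b,
          ({(e (t + 1)).1.2} : Set (JointObs O₀ O)).indicator 1 b.2 * f b.1
            ∂(κ (x ⟨t, mem_Iic.2 le_rfl⟩).1.1)) x := by
      intro x
      rw [lintegral_const_mul _ hs]
      by_cases h : x ∈ agreeSet S t e
      · rw [Kernel.sectR_apply, lintegral_stepTest_nextStep M hf e v t h]
        simp [h, κ, Kernel.comap_apply]
      · simp [h]
    have hκ : Measurable fun s => ∫⁻ b,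
          ({(e (t + 1)).1.2} : Set (JointObs O₀ O)).indicator 1 b.2 * f b.1 ∂(κ s) :=
      hF.lintegral_kernel
    have hmeas : Measurable ((agreeSet S t e).indicator fun x : ∀ i : Iic t, Step S O₀ O A i =>
        ∫⁻ b, ({(e (t + 1)).1.2} : Set (JointObs O₀ O)).indicator 1 b.2 * f b.1
          ∂(κ (x ⟨t, mem_Iic.2 le_rfl⟩).1.1)) :=
      (hκ.comp (by fun_prop)).indicator (measurableSet_agreeSet t e)
    simp_rw [hx]
    rw [lintegral_const_mul, lintegral_map]
    · change _ * ∫⁻ ω, _ ∂(M.policyLaw v) = _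
      -- The induction hypothesis is applied to the function `f` pulled back through one transition,
      -- hence its form for all measurable `f`.
      rw [ih v _ hκ, lintegral_smul_measure, lintegral_map hf measurable_fst,
        ← lintegral_indicator hm, Measure.lintegral_bind κ.aemeasurable, weight_succ]
      · have hi : ∀ b : S × JointObs O₀ O,
            (Prod.snd ⁻¹' {(e (t + 1)).1.2} : Set (S × JointObs O₀ O)).indicator
              (fun a => f a.1) b =
            ({(e (t + 1)).1.2} : Set (JointObs O₀ O)).indicator 1 b.2 * f b.1 := by
          intro b
          by_cases hb : b.2 = (e (t + 1)).1.2 <;> simp [hb]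
        simp_rw [hi, ENNReal.smul_def, smul_eq_mul, ENNReal.coe_mul]
        ring
      · exact ((hf.comp measurable_fst).indicator hm).aemeasurable
    · exact hmeas
    · exact measurable_frestrictLe t
    · exact hmeas

/-- The law of everything except the states under a policy. -/
theorem exists_policyLaw_agreeSet (e : Traj Unit O₀ O A) (t : ℕ) :
    ∃ g : ℝ≥0, ∀ v : Policy O₀ O A,
      M.policyLaw v (frestrictLe t ⁻¹' agreeSet S t e) = (weight v t e * g : ℝ≥0) := by
  obtain ⟨G, hG, h⟩ := M.exists_stateMeasure e t
  refine ⟨(G Set.univ).toNNReal, fun v => ?_⟩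
  have hm : MeasurableSet (frestrictLe t ⁻¹' agreeSet S t e : Set (Traj S O₀ O A)) :=
    (measurable_frestrictLe t) (measurableSet_agreeSet t e)
  rw [ENNReal.coe_mul, ENNReal.coe_toNNReal (measure_ne_top G _)]
  have h1 := h v 1 measurable_one
  simp only [Pi.one_apply, lintegral_one] at h1
  rw [← h1, ← lintegral_indicator_one hm]
  rfl

end Model

end Factorization

/-! ### Histories without states, and what the occupation measures record of them -/

section History

variable {N : ℕ} {S : Type uS} {O₀ : Type uC} {O : Fin N → Type uO} {A : Fin N → Type uA}

/-- What happens up to time `t`, except for the states. -/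
abbrev Hist (O₀ : Type uC) (O : Fin N → Type uO) (A : Fin N → Type uA) (t : ℕ) :=
  ∀ i : Iic t, Step Unit O₀ O A i

/-- The history up to time `t` along a trajectory. -/
def Traj.hist (t : ℕ) (ω : Traj S O₀ O A) : Hist O₀ O A t := fun i => Step.forget (ω i)

theorem hist_preimage_frestrictLe (t : ℕ) (e : Traj Unit O₀ O A) :
    Traj.hist t ⁻¹' {frestrictLe t e} =
      (frestrictLe t ⁻¹' agreeSet S t e : Set (Traj S O₀ O A)) := by
  ext ω
  exact funext_iff

/-- The pair that the coordinator-level occupation measure records, as a function of the history. -/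
def Hist.coordPair {T : ℕ∞} (t : Times T) (d : Hist O₀ O A t) : CoordPairs O₀ O A T :=
  CoordPairs.mk t ((fun i => (d ⟨i, mem_Iic.2 (Nat.lt_succ_iff.1 i.2)⟩).1.2.1,
    fun s => (d ⟨s, mem_Iic.2 s.2.le⟩).2.1), (d ⟨t, mem_Iic.2 le_rfl⟩).2.1)

/-- The pair that the agent-level occupation measure records, as a function of the history. -/
def Hist.jointPair {T : ℕ∞} (t : Times T) (d : Hist O₀ O A t) : JointPairs O₀ O A T :=
  JointPairs.mk t ((fun i => (d ⟨i, mem_Iic.2 (Nat.lt_succ_iff.1 i.2)⟩).1.2,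
    fun s => (d ⟨s, mem_Iic.2 s.2.le⟩).2.2), (d ⟨t, mem_Iic.2 le_rfl⟩).2.2)

end History

/-- A series of continuous functions with values in `[0, ∞]` that is dominated by a convergent
series is continuous. -/
theorem continuous_tsum_of_le {Z ι : Type*} [TopologicalSpace Z] {a : ι → Z → ℝ≥0∞}
    {u : ι → ℝ≥0∞} (hu : ∑' i, u i ≠ ∞) (h : ∀ i z, a i z ≤ u i) (hc : ∀ i, Continuous (a i)) :
    Continuous fun z => ∑' i, a i z := by
  have hui : ∀ i, u i ≠ ∞ := fun i => ENNReal.ne_top_of_tsum_ne_top hu i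
  have ha : ∀ i z, a i z ≠ ∞ := fun i z => ne_top_of_le_ne_top (hui i) (h i z)
  have hs : Summable fun i => (u i).toReal := ENNReal.summable_toReal hu
  have hsz : ∀ z, ∑' i, a i z ≠ ∞ := fun z =>
    ne_top_of_le_ne_top hu (ENNReal.tsum_le_tsum fun i => h i z)
  have hcont : Continuous fun z => ∑' i, (a i z).toReal := by
    -- The Weierstrass test is applied to real values; finiteness of all terms and sums allows the
    -- passage there and back.
    refine continuous_tsum (fun i => ?_) hs fun i z => ?_
    · exact continuous_iff_continuousAt.2 fun z =>
        (ENNReal.tendsto_toReal (ha i z)).comp (hc i).continuousAt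
    · rw [Real.norm_of_nonneg ENNReal.toReal_nonneg]
      exact ENNReal.toReal_mono (hui i) (h i z)
  have heq : (fun z => ∑' i, a i z) = fun z => ENNReal.ofReal (∑' i, (a i z).toReal) := by
    funext z
    rw [← ENNReal.tsum_toReal_eq fun i => ha i z, ENNReal.ofReal_toReal (hsz z)]
  rw [heq]
  exact ENNReal.continuous_ofReal.comp hcont

/-! ### Laws of histories and their dependence on the search space -/

section Laws

variable {N : ℕ} {S : Type uS} {O₀ : Type uC} {O : Fin N → Type uO} {A : Fin N → Type uA}
  [MeasurableSpace S]
  [Finite O₀] [MeasurableSpace O₀] [DiscreteMeasurableSpace O₀]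
  [∀ n, Finite (O n)] [∀ n, MeasurableSpace (O n)] [∀ n, DiscreteMeasurableSpace (O n)]
  [∀ n, Finite (A n)] [∀ n, MeasurableSpace (A n)] [∀ n, DiscreteMeasurableSpace (A n)]

theorem measurable_hist (t : ℕ) : Measurable (Traj.hist t : Traj S O₀ O A → Hist O₀ O A t) :=
  measurable_pi_lambda _ fun i => measurable_forget.comp (measurable_pi_apply (i : ℕ))

theorem continuous_searchWeight (X : SearchSpace) (t : ℕ) (e : Traj Unit O₀ O A) :
    Continuous fun x : X.Elem O₀ O A => searchWeight X x t e := by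
  let f : BoundedContinuousFunction (Policy O₀ O A) ℝ≥0 :=
    BoundedContinuousFunction.mkOfCompact ⟨fun v => weight v t e, continuous_weight t e⟩
  have hf : Continuous fun ν : ProbabilityMeasure (Policy O₀ O A) =>
      ∫⁻ v, weight v t e ∂(ν : Measure (Policy O₀ O A)) :=
    ProbabilityMeasure.continuous_lintegral_boundedContinuousFunction f
  cases X with
  | behavioral => exact ENNReal.continuous_coe.comp (continuous_weight t e)
  | mixtures => exact hf
  | pureMixtures => exact hf.comp continuous_subtype_val

/-- Occupation measures of a law of the trajectory, for the observables `φ`. -/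
def occ {Y : Type*} [MeasurableSpace Y] {T : ℕ∞} (α : ℝ≥0)
    (φ : Times T → Traj S O₀ O A → Y) (μ : Measure (Traj S O₀ O A)) : Measure Y :=
  Measure.sum fun t : Times T => α ^ (t : ℕ) • μ.map (φ t)

theorem occ_apply {Y : Type*} [MeasurableSpace Y] {T : ℕ∞} (α : ℝ≥0)
    {φ : Times T → Traj S O₀ O A → Y} (hφ : ∀ t, Measurable (φ t))
    (μ : Measure (Traj S O₀ O A)) {s : Set Y} (hs : MeasurableSet s) :
    occ α φ μ s = ∑' t : Times T, (α : ℝ≥0∞) ^ (t : ℕ) * μ (φ t ⁻¹' s) := by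
  rw [occ, Measure.sum_apply _ hs]
  congr 1 with t
  rw [Measure.smul_apply, Measure.map_apply (hφ t) hs, ENNReal.smul_def, smul_eq_mul,
    ENNReal.coe_pow]

theorem occ_add_smul {Y : Type*} [MeasurableSpace Y] {T : ℕ∞} (α : ℝ≥0)
    {φ : Times T → Traj S O₀ O A → Y} (hφ : ∀ t, Measurable (φ t))
    (μ ν : Measure (Traj S O₀ O A)) (a b : ℝ≥0) :
    occ α φ (a • μ + b • ν) = a • occ α φ μ + b • occ α φ ν := by
  ext s hs
  simp only [Measure.add_apply, Measure.smul_apply, occ_apply α hφ _ hs, ENNReal.smul_def,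
    smul_eq_mul]
  rw [← ENNReal.tsum_mul_left, ← ENNReal.tsum_mul_left, ← ENNReal.tsum_add]
  congr 1 with t
  ring

namespace Model

variable (M : Model S O₀ O A)

theorem mixtureLaw_snd_apply (ν : ProbabilityMeasure (Policy O₀ O A)) {s : Set (Traj S O₀ O A)}
    (hs : MeasurableSet s) :
    (M.mixtureLaw ν).snd s = ∫⁻ v, M.policyLaw v s ∂(ν : Measure (Policy O₀ O A)) := by
  rw [Measure.snd_apply hs, mixtureLaw, Measure.compProd_apply (measurable_snd hs)]
  rfl

/-- The probability of a history depends on the element of the search space through the weight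
only, and linearly. -/
theorem exists_law_hist (t : ℕ) (e : Traj Unit O₀ O A) :
    ∃ g : ℝ≥0, ∀ (X : SearchSpace) (x : X.Elem O₀ O A),
      M.law X x (Traj.hist t ⁻¹' {frestrictLe t e}) = searchWeight X x t e * g := by
  obtain ⟨g, hg⟩ := M.exists_policyLaw_agreeSet e t
  simp_rw [← hist_preimage_frestrictLe, ENNReal.coe_mul] at hg
  have hm : MeasurableSet (Traj.hist t ⁻¹' {frestrictLe t e} : Set (Traj S O₀ O A)) :=
    measurable_hist t .of_discrete
  have hmix : ∀ ν : ProbabilityMeasure (Policy O₀ O A),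
      (M.mixtureLaw ν).snd (Traj.hist t ⁻¹' {frestrictLe t e}) =
        (∫⁻ v, weight v t e ∂(ν : Measure (Policy O₀ O A))) * g := by
    intro ν
    rw [mixtureLaw_snd_apply M ν hm, ← lintegral_mul_const]
    · simp_rw [hg]
    · exact (continuous_weight t e).measurable.coe_nnreal_ennreal
  refine ⟨g, fun X x => ?_⟩
  cases X with
  | behavioral => exact hg x
  | mixtures => exact hmix x
  | pureMixtures => exact hmix x.1

/-- Weights are indexed by infinite trajectories, but a finite history need not extend to one if
some space is empty. In that case its event is empty as well. -/
theorem hist_preimage_singleton (S : Type uS) {t : ℕ} (d : Hist O₀ O A t) :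
    (Traj.hist t ⁻¹' {d} : Set (Traj S O₀ O A)) = ∅ ∨ ∃ e : Traj Unit O₀ O A,
      d = frestrictLe t e := by
  rcases Set.eq_empty_or_nonempty (Traj.hist t ⁻¹' {d} : Set (Traj S O₀ O A)) with h | ⟨ω, hω⟩
  · exact .inl h
  · exact .inr ⟨Traj.forget ω, (Set.mem_singleton_iff.1 hω).symm⟩

theorem law_map_hist_eq {X Y : SearchSpace} {x : X.Elem O₀ O A} {y : Y.Elem O₀ O A}
    (h : searchWeight X x = searchWeight Y y) (t : ℕ) :
    (M.law X x).map (Traj.hist t) = (M.law Y y).map (Traj.hist t) := by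
  refine Measure.ext_of_singleton fun d => ?_
  rw [Measure.map_apply (measurable_hist t) .of_discrete,
    Measure.map_apply (measurable_hist t) .of_discrete]
  rcases hist_preimage_singleton S d with h0 | ⟨e, rfl⟩
  · simp [h0]
  · obtain ⟨g, hg⟩ := M.exists_law_hist t e
    rw [hg, hg, h]

theorem continuous_law_hist_singleton (X : SearchSpace) (t : ℕ) (d : Hist O₀ O A t) :
    Continuous fun x : X.Elem O₀ O A => M.law X x (Traj.hist t ⁻¹' {d}) := by
  rcases hist_preimage_singleton S d with h0 | ⟨e, rfl⟩
  · simpa [h0] using continuous_const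
  · obtain ⟨g, hg⟩ := M.exists_law_hist t e
    simp_rw [hg]
    exact (ENNReal.continuous_mul_const ENNReal.coe_ne_top).comp (continuous_searchWeight X t e)

/-- There are finitely many histories, so the integral is a finite combination of their
probabilities. -/
theorem continuous_lintegral_hist (X : SearchSpace) (t : ℕ) (f : Hist O₀ O A t → ℝ≥0) :
    Continuous fun x : X.Elem O₀ O A => ∫⁻ ω, f (Traj.hist t ω) ∂(M.law X x) := by
  have := Fintype.ofFinite (Hist O₀ O A t)
  have h : ∀ x : X.Elem O₀ O A, ∫⁻ ω, f (Traj.hist t ω) ∂(M.law X x) =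
      ∑ d, f d * M.law X x (Traj.hist t ⁻¹' {d}) := by
    intro x
    rw [← lintegral_map (f := fun d => (f d : ℝ≥0∞)) .of_discrete (measurable_hist t),
      lintegral_fintype]
    simp_rw [Measure.map_apply (measurable_hist t) (MeasurableSet.of_discrete)]
  simp_rw [h]
  exact continuous_finsetSum _ fun d _ => (ENNReal.continuous_const_mul ENNReal.coe_ne_top).comp
    (M.continuous_law_hist_singleton X t d)

theorem continuous_law_hist (X : SearchSpace) (t : ℕ) (B : Set (Hist O₀ O A t)) :
    Continuous fun x : X.Elem O₀ O A => M.law X x (Traj.hist t ⁻¹' B) := by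
  classical
  convert M.continuous_lintegral_hist X t (B.indicator 1) using 2 with x
  rw [← lintegral_indicator_one (measurable_hist t .of_discrete)]
  congr 1 with ω
  by_cases h : Traj.hist t ω ∈ B <;> simp [h]

/-! ### Occupation measures: equality of ranges, convexity, continuity, compactness -/

section Occupation

variable {Y : Type*} [MeasurableSpace Y] [DiscreteMeasurableSpace Y] {T : ℕ∞} {α : ℝ≥0}
  {F : ∀ t : Times T, Hist O₀ O A t → Y}

theorem occ_law_eq {X X' : SearchSpace} {x : X.Elem O₀ O A} {x' : X'.Elem O₀ O A}
    (h : searchWeight X x = searchWeight X' x') :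
    occ α (fun t => F t ∘ Traj.hist t) (M.law X x) =
      occ α (fun t => F t ∘ Traj.hist t) (M.law X' x') := by
  unfold occ
  congr 1 with t : 1
  rw [← Measure.map_map .of_discrete (measurable_hist _), M.law_map_hist_eq h,
    Measure.map_map .of_discrete (measurable_hist _)]

theorem range_occ_law (X X' : SearchSpace) :
    (Set.range fun x : X.Elem O₀ O A => occ α (fun t => F t ∘ Traj.hist t) (M.law X x)) =
      Set.range fun x : X'.Elem O₀ O A => occ α (fun t => F t ∘ Traj.hist t) (M.law X' x) := by
  refine Set.Subset.antisymm ?_ ?_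
  · rintro _ ⟨x, rfl⟩
    obtain ⟨x', h⟩ := exists_searchWeight_eq X X' x
    exact ⟨x', M.occ_law_eq h⟩
  · rintro _ ⟨x, rfl⟩
    obtain ⟨x', h⟩ := exists_searchWeight_eq X' X x
    exact ⟨x', M.occ_law_eq h⟩

/-- The law under a mixture of two mixtures. -/
theorem exists_law_mixtures_eq (ν ν' : ProbabilityMeasure (Policy O₀ O A)) {a b : ℝ≥0}
    (hab : a + b = 1) : ∃ ν'' : ProbabilityMeasure (Policy O₀ O A),
      M.law .mixtures ν'' = a • M.law .mixtures ν + b • M.law .mixtures ν' := by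
  have hp : IsProbabilityMeasure
      (a • (ν : Measure (Policy O₀ O A)) + b • (ν' : Measure (Policy O₀ O A))) := by
    refine ⟨?_⟩
    simp only [Measure.add_apply, Measure.smul_apply, measure_univ, ENNReal.smul_def, smul_eq_mul,
      mul_one]
    exact_mod_cast hab
  let ν'' : ProbabilityMeasure (Policy O₀ O A) := ⟨_, hp⟩
  refine ⟨ν'', ?_⟩
  ext s hs
  change (M.mixtureLaw ν'').snd s = (a • (M.mixtureLaw ν).snd + b • (M.mixtureLaw ν').snd) s
  simp only [Measure.add_apply, Measure.smul_apply]
  rw [mixtureLaw_snd_apply M _ hs, mixtureLaw_snd_apply M _ hs, mixtureLaw_snd_apply M _ hs]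
  change ∫⁻ v, M.policyLaw v s ∂(a • (ν : Measure (Policy O₀ O A)) + b • ν'.toMeasure) = _
  rw [lintegral_add_measure, lintegral_smul_measure, lintegral_smul_measure]

/-- By equality of ranges the search space may be taken to be `.mixtures`, where convex combinations
of laws come from convex combinations of mixing measures and `occ` is linear. -/
theorem convex_range_occ_law (X : SearchSpace) :
    Convex ℝ≥0
      (Set.range fun x : X.Elem O₀ O A => occ α (fun t => F t ∘ Traj.hist t) (M.law X x)) := by
  rw [M.range_occ_law X .mixtures]
  rintro _ ⟨ν, rfl⟩ _ ⟨ν', rfl⟩ a b _ _ hab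
  obtain ⟨ν'', h⟩ := M.exists_law_mixtures_eq ν ν' hab
  refine ⟨ν'', ?_⟩
  beta_reduce
  rw [h, occ_add_smul α fun t => Measurable.of_discrete.comp (measurable_hist _)]

/-- Pointwise continuity: a point can be reached at one time step only. -/
theorem continuous_occ_law_apply (X : SearchSpace) (p : Y) (t₀ : Times T)
    (h : ∀ t d, F t d = p → t = t₀) : Continuous fun x : X.Elem O₀ O A =>
      occ α (fun t => F t ∘ Traj.hist t) (M.law X x) {p} := by
  have heq : ∀ x : X.Elem O₀ O A, occ α (fun t => F t ∘ Traj.hist t) (M.law X x) {p} =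
      -- All terms of the series but that of `t₀` vanish, so no convergence is needed, even for `T =
      -- ⊤` and `α = 1`.
      (α : ℝ≥0∞) ^ (t₀ : ℕ) * M.law X x (Traj.hist t₀ ⁻¹' (F t₀ ⁻¹' {p})) := by
    intro x
    rw [occ_apply α (fun t => Measurable.of_discrete.comp (measurable_hist _)) _ .of_discrete,
      tsum_eq_single t₀]
    · rfl
    · intro t ht
      have : (F t ∘ Traj.hist t ⁻¹' {p} : Set (Traj S O₀ O A)) = ∅ :=
        Set.eq_empty_of_forall_notMem fun ω hω => ht (h t _ hω)
      rw [this, measure_empty, mul_zero]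
  simp_rw [heq]
  exact (ENNReal.continuous_const_mul (ENNReal.pow_ne_top ENNReal.coe_ne_top)).comp
    (M.continuous_law_hist X _ _)

/-- Each time step contributes a continuous function, bounded by the discount factor times the sup
norm of `f`; finite total mass makes these bounds summable. -/
theorem continuous_lintegral_occ_law [TopologicalSpace Y] (X : SearchSpace) (hα : totalMass T α < ∞)
    (f : BoundedContinuousFunction Y ℝ≥0) : Continuous fun x : X.Elem O₀ O A =>
      ∫⁻ y, f y ∂(occ α (fun t => F t ∘ Traj.hist t) (M.law X x)) := by
  have heq : ∀ x : X.Elem O₀ O A,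
      ∫⁻ y, f y ∂(occ α (fun t => F t ∘ Traj.hist t) (M.law X x)) =
        ∑' t : Times T, (α : ℝ≥0∞) ^ (t : ℕ) *
          ∫⁻ ω, f (F t (Traj.hist t ω)) ∂(M.law X x) := by
    intro x
    rw [occ, lintegral_sum_measure]
    congr 1 with t
    rw [lintegral_smul_measure, lintegral_map .of_discrete
      (Measurable.of_discrete.comp (measurable_hist _)), ENNReal.smul_def, smul_eq_mul,
      ENNReal.coe_pow]
    rfl
  simp_rw [heq]
  refine continuous_tsum_of_le (u := fun t : Times T => (α : ℝ≥0∞) ^ (t : ℕ) * (nndist f 0 : ℝ≥0))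
    ?_ (fun t x => ?_) fun t => ?_
  · rw [ENNReal.tsum_mul_right]
    exact ENNReal.mul_ne_top hα.ne ENNReal.coe_ne_top
  · gcongr
    refine (lintegral_mono fun ω =>
      ENNReal.coe_le_coe.2 (BoundedContinuousFunction.NNReal.upper_bound f _)).trans ?_
    simp
  · exact (ENNReal.continuous_const_mul (ENNReal.pow_ne_top ENNReal.coe_ne_top)).comp
      (M.continuous_lintegral_hist X t fun d => f (F t d))

/-- The range equals that of the behavioral policies, which is the image of a compact space under a
map continuous for the weak topology. -/
theorem isCompact_range_finiteMeasure [TopologicalSpace Y] [OpensMeasurableSpace Y]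
    (hα : totalMass T α < ∞) (X : SearchSpace)
    (Q : ∀ X : SearchSpace, X.Elem O₀ O A → FiniteMeasure Y)
    (hQ : ∀ X x, (Q X x : Measure Y) = occ α (fun t => F t ∘ Traj.hist t) (M.law X x)) :
    IsCompact (Set.range (Q X)) := by
  have hr : Set.range (Q X) = Set.range (Q .behavioral) := by
    apply FiniteMeasure.toMeasure_injective.image_injective
    simp_rw [← Set.range_comp, Function.comp_def, hQ]
    exact M.range_occ_law X .behavioral
  have : CompactSpace (SearchSpace.behavioral.Elem O₀ O A) :=
    inferInstanceAs (CompactSpace (Policy O₀ O A))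
  rw [hr]
  refine isCompact_range (FiniteMeasure.continuous_iff_forall_continuous_lintegral.2 fun f => ?_)
  simp_rw [hQ]
  exact M.continuous_lintegral_occ_law .behavioral hα f

end Occupation

end Model

end Laws

end TeamPOMDP

end

/-! ### The theorem -/

theorem mainTheorem4 {N : ℕ} {S O₀ : Type*} {O A : Fin N → Type*}
    [TopologicalSpace S] [MeasurableSpace S] [BorelSpace S]
    [Finite O₀] [MeasurableSpace O₀] [DiscreteMeasurableSpace O₀]
    [∀ n, Finite (O n)] [∀ n, MeasurableSpace (O n)] [∀ n, DiscreteMeasurableSpace (O n)]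
    [∀ n, Finite (A n)] [∀ n, MeasurableSpace (A n)] [∀ n, DiscreteMeasurableSpace (A n)]
    (M : Model S O₀ O A) (X : SearchSpace) :
    -- (A)
    ((∀ p, Continuous fun x : X.Elem O₀ O A => M.coordOcc ⊤ 1 X x {p}) ∧
      ∀ (T : ℕ∞) (α : ℝ≥0) (h : Admissible T α),
        (∀ x : X.Elem O₀ O A, M.coordOcc T α X x Set.univ = totalMass T α) ∧
        IsCompact (Set.range (M.coordOccFinite h X))) ∧
    -- (B)
    (Convex ℝ≥0 (Set.range (M.coordOcc ⊤ 1 X)) ∧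
      Set.range (M.coordOcc ⊤ 1 X) = Set.range (M.coordOcc ⊤ 1 .behavioral)) ∧
    -- (C)
    ((∀ p, Continuous fun x : X.Elem O₀ O A => M.jointOcc ⊤ 1 X x {p}) ∧
      ∀ (T : ℕ∞) (α : ℝ≥0) (h : Admissible T α),
        (∀ x : X.Elem O₀ O A, M.jointOcc T α X x Set.univ = totalMass T α) ∧
        IsCompact (Set.range (M.jointOccFinite h X))) ∧
    -- (D)
    (Convex ℝ≥0 (Set.range (M.jointOcc ⊤ 1 X)) ∧
      Set.range (M.jointOcc ⊤ 1 X) = Set.range (M.jointOcc ⊤ 1 .behavioral)) := by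

  have hc : ∀ (T : ℕ∞) (α : ℝ≥0) (X : SearchSpace), M.coordOcc T α X =
      fun x => occ α (fun t => Hist.coordPair t ∘ Traj.hist t) (M.law X x) :=
    fun _ _ _ => rfl
  have hj : ∀ (T : ℕ∞) (α : ℝ≥0) (X : SearchSpace), M.jointOcc T α X =
      fun x => occ α (fun t => Hist.jointPair t ∘ Traj.hist t) (M.law X x) :=
    fun _ _ _ => rfl
  refine ⟨⟨fun p => ?_, fun T α h => ⟨M.coordOcc_univ T α X, ?_⟩⟩, ⟨?_, ?_⟩,
    ⟨fun p => ?_, fun T α h => ⟨M.jointOcc_univ T α X, ?_⟩⟩, ⟨?_, ?_⟩⟩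
  · rw [hc]
    -- The time component `p.1` is the only time step at which `p` can be recorded.
    exact M.continuous_occ_law_apply (F := fun t => Hist.coordPair t) X p p.1
      fun t d h => congrArg Sigma.fst h
  · exact M.isCompact_range_finiteMeasure (F := fun t => Hist.coordPair t) h.totalMass_lt_top X
      (M.coordOccFinite h) fun X x => congrFun (hc T α X) x
  · rw [hc]
    exact M.convex_range_occ_law (F := fun t => Hist.coordPair t) X
  · rw [hc, hc]
    exact M.range_occ_law (F := fun t => Hist.coordPair t) X .behavioral
  · rw [hj]
    exact M.continuous_occ_law_apply (F := fun t => Hist.jointPair t) X p p.1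
      fun t d h => congrArg Sigma.fst h
  · exact M.isCompact_range_finiteMeasure (F := fun t => Hist.jointPair t) h.totalMass_lt_top X
      (M.jointOccFinite h) fun X x => congrFun (hj T α X) x
  · rw [hj]
    exact M.convex_range_occ_law (F := fun t => Hist.jointPair t) X
  · rw [hj, hj]
    exact M.range_occ_law (F := fun t => Hist.jointPair t) X .behavioral
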